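/- Let $F$ be a field of characteristic $0$ and let $\Theta$ be the split octonion algebra over $F$ in the Zorn model: its elements are $x=\begin{pmatrix} a & v\\ \phi & d\end{pmatrix}$ with $a,d\in F$, $v\in V_3=F^3$, $\phi\in V_3^\vee$, with multiplication $$\begin{pmatrix} a & v\\ \phi & d\end{pmatrix}\begin{pmatrix} a' & v'\\ \phi' & d'\end{pmatrix}=\begin{pmatrix} aa'+\phi'(v) & av'+d'v-\phi\wedge\phi'\\ a'\phi+d\phi'+v\wedge v' & \phi(v')+dd'\end{pmatrix},$$ where $\wedge^2V_3\simeq V_3^\vee$ and $\wedge^2V_3^\vee\simeq V_3$ are the identifications given by the standard volume form (cross products in coordinates). Its conjugation, norm and trace are $x^*=\begin{pmatrix} d & -v\\ -\phi & a\end{pmatrix}$, $n(x)=ad-\phi(v)$ and $\operatorname{tr}(x)=a+d$. Let $V_7=\{x\in\Theta:\operatorname{tr}(x)=0\}$ and $\epsilon_1=\begin{pmatrix}1&0\\0&0\end{pmatrix}$. Let $G_2$ be the linear algebraic $F$-group of automorphisms of $\Theta$. A line (one-dimensional subspace) $\ell\subseteq\Theta$ is called isotropic if $n$ vanishes on $\ell$.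 1. The group $G_2(F)$ has exactly two orbits on the set of isotropic lines in $\Theta$. Two isotropic lines $\ell,\ell'$ lie in the same orbit if and only if they are both contained in $V_7$ or both not contained in $V_7$. For every $v\in V_3$ with $v\neq0$, the line $F\begin{pmatrix}0&v\\0&0\end{pmatrix}$ is isotropic and contained in $V_7$; the line $F\epsilon_1$ is isotropic and not contained in $V_7$. 2. For every isotropic line $\ell\subseteq V_7$, the stabilizer $P(\ell)$ of $\ell$ in $G_2$ is a maximal parabolic subgroup of $G_2$. That is, for every algebraically closed extension field $K$ of $F$, the stabilizer of $\ell\otimes_F K$ in $G_2(K)$ is a Zariski closed proper subgroup of $G_2(K)$ that contains a Borel subgroup (a maximal Zariski closed connected solvable subgroup), and it is maximal among all proper subgroups with these properties. 3. The stabilizer of the line $F\epsilon_1$ in $G_2$ is $\mathrm{SL}_3$ acting component-wise on the Zorn model. That is, for every commutative $F$-algebra $R$, the map sending $A\in \mathrm{SL}_3(R)$ to $$\begin{pmatrix} a & v\\ \phi & d\end{pmatrix}\mapsto\begin{pmatrix} a & Av\\ \phi\circ A^{-1} & d\end{pmatrix}$$ is an injective homomorphism into $\mathrm{GL}(\Theta\otimes_F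 R)$ whose image is the subgroup of all $g\in G_2(R)$ with $g(R\epsilon_1)=R\epsilon_1$. -/

import Mathlib

open scoped Matrix Pointwise

universe u

/-- The split octonions over a commutative ring `R` in the Zorn model: matrices
`(a, v; φ, d)` with `a d : R`, `v` in `V₃ = R³` (coordinates in the basis `e₁, e₂, e₃`)
and `φ` in the dual of `V₃` (coordinates in the dual basis). In these coordinates
`φ(v)` is the dot product `φ ⬝ᵥ v`, and `v ∧ v'`, `φ ∧ φ'` are cross products. -/
@[ext]
structure Zorn (R : Type u) where
  a : R
  v : Fin 3 → R
  φ : Fin 3 → R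
  d : R

namespace Zorn

variable {R : Type u}

section Ring

variable [CommRing R]

instance : Zero (Zorn R) := ⟨⟨0, 0, 0, 0⟩⟩
instance : Add (Zorn R) := ⟨fun x y => ⟨x.a + y.a, x.v + y.v, x.φ + y.φ, x.d + y.d⟩⟩
instance : Neg (Zorn R) := ⟨fun x => ⟨-x.a, -x.v, -x.φ, -x.d⟩⟩
instance : SMul R (Zorn R) := ⟨fun r x => ⟨r * x.a, r • x.v, r • x.φ, r * x.d⟩⟩
instance : One (Zorn R) := ⟨⟨1, 0, 0, 1⟩⟩
instance : Mul (Zorn R) := ⟨fun x y =>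
  ⟨x.a * y.a + y.φ ⬝ᵥ x.v,
   x.a • y.v + y.d • x.v - crossProduct x.φ y.φ,
   y.a • x.φ + x.d • y.φ + crossProduct x.v y.v,
   x.φ ⬝ᵥ y.v + x.d * y.d⟩⟩

@[simp] theorem zero_a : (0 : Zorn R).a = 0 := rfl
@[simp] theorem zero_v : (0 : Zorn R).v = 0 := rfl
@[simp] theorem zero_φ : (0 : Zorn R).φ = 0 := rfl
@[simp] theorem zero_d : (0 : Zorn R).d = 0 := rfl
@[simp] theorem add_a (x y : Zorn R) : (x + y).a = x.a + y.a := rfl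
@[simp] theorem add_v (x y : Zorn R) : (x + y).v = x.v + y.v := rfl
@[simp] theorem add_φ (x y : Zorn R) : (x + y).φ = x.φ + y.φ := rfl
@[simp] theorem add_d (x y : Zorn R) : (x + y).d = x.d + y.d := rfl
@[simp] theorem neg_a (x : Zorn R) : (-x).a = -x.a := rfl
@[simp] theorem neg_v (x : Zorn R) : (-x).v = -x.v := rfl
@[simp] theorem neg_φ (x : Zorn R) : (-x).φ = -x.φ := rfl
@[simp] theorem neg_d (x : Zorn R) : (-x).d = -x.d := rfl
@[simp] theorem smul_a (r : R) (x : Zorn R) : (r • x).a = r * x.a := rfl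
@[simp] theorem smul_v (r : R) (x : Zorn R) : (r • x).v = r • x.v := rfl
@[simp] theorem smul_φ (r : R) (x : Zorn R) : (r • x).φ = r • x.φ := rfl
@[simp] theorem smul_d (r : R) (x : Zorn R) : (r • x).d = r * x.d := rfl

instance : AddCommGroup (Zorn R) where
  add_assoc x y z := by ext <;> simp [add_assoc]
  zero_add x := by ext <;> simp
  add_zero x := by ext <;> simp
  add_comm x y := by ext <;> simp [add_comm]
  neg_add_cancel x := by ext <;> simp
  nsmul := nsmulRec
  zsmul := zsmulRec

instance : Module R (Zorn R) where
  one_smul x := by ext <;> simp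
  mul_smul r s x := by ext <;> simp [mul_assoc]
  smul_zero r := by ext <;> simp
  smul_add r x y := by ext <;> simp [mul_add]
  add_smul r s x := by ext <;> simp [add_mul]
  zero_smul x := by ext <;> simp

/-- The conjugate `x ↦ x*`. -/
def conj (x : Zorn R) : Zorn R := ⟨x.d, -x.v, -x.φ, x.a⟩

/-- The norm `n(x) = ad - φ(v)`. -/
def norm (x : Zorn R) : R := x.a * x.d - x.φ ⬝ᵥ x.v

/-- The trace `tr(x) = a + d`. -/
def trace : Zorn R →ₗ[R] R where
  toFun x := x.a + x.d
  map_add' x y := by simp; ring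
  map_smul' r x := by simp; ring

variable (R)

/-- The traceless octonions `V₇`. -/
def V7 : Submodule R (Zorn R) := LinearMap.ker trace

/-- The idempotent `ε₁ = (1, 0; 0, 0)`. -/
def eps1 : Zorn R := ⟨1, 0, 0, 0⟩

/-- The `R`-points of the algebraic group `G₂`: the automorphisms of the octonion algebra
with its unit and conjugation, as a subgroup of `GL(Zorn R)`. -/
def G2 : Subgroup (Zorn R ≃ₗ[R] Zorn R) where
  carrier := {g | g 1 = 1 ∧ (∀ x, g (conj x) = conj (g x)) ∧ ∀ x y, g (x * y) = g x * g y}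
  one_mem' := ⟨rfl, fun _ => rfl, fun _ _ => rfl⟩
  mul_mem' := by
    rintro g h ⟨g1, g2, g3⟩ ⟨h1, h2, h3⟩
    exact ⟨by simp [h1, g1], fun x => by simp [h2, g2], fun x y => by simp [h3, g3]⟩
  inv_mem' := by
    rintro g ⟨g1, g2, g3⟩
    refine ⟨?_, fun x => ?_, fun x y => ?_⟩ <;> apply g.injective <;>
      change g (g.symm _) = _
    · simp [g1]
    · rw [g2]; change _ = conj (g (g.symm x)); simp
    · rw [g3]; change _ = g (g.symm x) * g (g.symm y); simp

/-- The action of `SL₃` on the Zorn model, component by component: trivially on `a` and `d`,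
by the standard representation on `v` and by its dual (inverse transpose) on `φ`. -/
def sl3Action : Matrix.SpecialLinearGroup (Fin 3) R →* (Zorn R ≃ₗ[R] Zorn R) where
  toFun A :=
    { toFun := fun x => ⟨x.a, A.1 *ᵥ x.v, (A⁻¹).1ᵀ *ᵥ x.φ, x.d⟩
      invFun := fun x => ⟨x.a, (A⁻¹).1 *ᵥ x.v, A.1ᵀ *ᵥ x.φ, x.d⟩
      map_add' := fun x y => by ext <;> simp [Matrix.mulVec_add]
      map_smul' := fun r x => by ext <;> simp [Matrix.mulVec_smul]
      left_inv := fun x => by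
        have h1 : (A⁻¹).1 * A.1 = 1 := congrArg Subtype.val (inv_mul_cancel A)
        ext1 <;> simp only [Matrix.mulVec_mulVec, ← Matrix.transpose_mul, h1,
          Matrix.transpose_one, Matrix.one_mulVec]
      right_inv := fun x => by
        have h1 : A.1 * (A⁻¹).1 = 1 := congrArg Subtype.val (mul_inv_cancel A)
        ext1 <;> simp only [Matrix.mulVec_mulVec, ← Matrix.transpose_mul, h1,
          Matrix.transpose_one, Matrix.one_mulVec] }
  map_one' := by
    apply LinearEquiv.ext
    intro x
    apply Zorn.ext <;> simp
  map_mul' A B := by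
    apply LinearEquiv.ext
    intro x
    apply Zorn.ext <;>
      simp [Matrix.mulVec_mulVec, ← Matrix.transpose_mul, -Matrix.SpecialLinearGroup.coe_inv]

end Ring

section Lines

variable (F : Type u) [Field F]

/-- Isotropic lines: one-dimensional subspaces of the octonions on which the norm vanishes. -/
@[ext]
structure IsotropicLine where
  line : Submodule F (Zorn F)
  finrank_eq_one : Module.finrank F line = 1
  norm_eq_zero : ∀ x ∈ line, norm x = 0

variable {F}

theorem mul_conj (x : Zorn F) : x * conj x = norm x • (1 : Zorn F) := by
  apply Zorn.ext
  · change x.a * x.d + (-x.φ) ⬝ᵥ x.v = (x.a * x.d - x.φ ⬝ᵥ x.v) * 1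
    simp; ring
  · change x.a • (-x.v) + x.a • x.v - crossProduct x.φ (-x.φ) = norm x • (0 : Fin 3 → F)
    simp
  · change x.d • x.φ + x.d • (-x.φ) + crossProduct x.v (-x.v) = norm x • (0 : Fin 3 → F)
    simp
  · change x.φ ⬝ᵥ (-x.v) + x.d * x.a = (x.a * x.d - x.φ ⬝ᵥ x.v) * 1
    simp; ring

theorem norm_map (g : G2 F) (x : Zorn F) : norm (g.1 x) = norm x := by
  obtain ⟨h1, h2, h3⟩ := g.2
  have h : norm (g.1 x) • (1 : Zorn F) = norm x • (1 : Zorn F) := by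
    rw [← mul_conj, ← h2, ← h3, mul_conj, map_smul, h1]
  have h' := congrArg Zorn.a h
  change norm (g.1 x) * 1 = norm x * 1 at h'
  simpa using h'

instance : MulAction (G2 F) (IsotropicLine F) where
  smul g ℓ :=
    { line := g • ℓ.line
      finrank_eq_one :=
        (LinearEquiv.finrank_eq (g.1.submoduleMap ℓ.line)).symm.trans ℓ.finrank_eq_one
      norm_eq_zero := by
        rintro _ ⟨x, hx, rfl⟩
        exact (norm_map g x).trans (ℓ.norm_eq_zero x hx) }
  one_smul ℓ := IsotropicLine.ext (one_smul (G2 F) ℓ.line)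
  mul_smul g h ℓ := IsotropicLine.ext (mul_smul g h ℓ.line)

/-- Extension of scalars of an octonion along `F → R`. -/
def map (R : Type u) [CommRing R] [Algebra F R] (x : Zorn F) : Zorn R :=
  ⟨algebraMap F R x.a, fun i => algebraMap F R (x.v i), fun i => algebraMap F R (x.φ i),
    algebraMap F R x.d⟩

/-- The `R`-submodule of the octonions over `R` generated by an `F`-subspace. -/
def baseChange (R : Type u) [CommRing R] [Algebra F R] (ℓ : Submodule F (Zorn F)) :
    Submodule R (Zorn R) :=
  Submodule.span R (map R '' (ℓ : Set (Zorn F)))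

/-- The `R`-points of the stabilizer in `G₂` of a subspace `ℓ` of the octonions over `F`:
all `g` in `G₂(R)` that map `ℓ ⊗ R` onto itself. -/
def stabilizerPoints (ℓ : Submodule F (Zorn F)) (R : Type u) [CommRing R] [Algebra F R] :
    Subgroup (Zorn R ≃ₗ[R] Zorn R) :=
  G2 R ⊓ MulAction.stabilizer (Zorn R ≃ₗ[R] Zorn R) (baseChange R ℓ)

end Lines

end Zorn

namespace LinearAlgebraicGroup

variable (K : Type u) [Field K]

/-- Polynomial functions on a finite-dimensional vector space: the algebra of functions
generated by the linear forms. -/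
def polynomialFunctions (W : Type u) [AddCommGroup W] [Module K W] : Subalgebra K (W → K) :=
  Algebra.adjoin K (Set.range fun f : Module.Dual K W => (f : W → K))

/-- The Zariski topology on a finite-dimensional vector space: the closed sets are the common
zero sets of families of polynomial functions. -/
abbrev zariskiTopology (W : Type u) [AddCommGroup W] [Module K W] : TopologicalSpace W :=
  TopologicalSpace.ofClosed
    {Z | ∃ S : Set (W → K), S ⊆ polynomialFunctions K W ∧ Z = {w | ∀ p ∈ S, p w = 0}}
    ⟨{1}, by simp [one_mem], by ext; simp⟩
    (by
      intro A hA
      choose S hS hZ using fun Z : A => hA Z.2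
      refine ⟨⋃ Z, S Z, Set.iUnion_subset hS, ?_⟩
      ext w
      simp only [Set.mem_sInter, Set.mem_iUnion, Set.mem_ofPred_eq]
      constructor
      · rintro h p ⟨Z, hp⟩
        have hw := h Z.1 Z.2
        rw [hZ Z] at hw
        exact hw p hp
      · intro h Z hZA
        rw [show Z = _ from hZ ⟨Z, hZA⟩]
        exact fun p hp => h p ⟨_, hp⟩)
    (by
      rintro _ ⟨S, hS, rfl⟩ _ ⟨T, hT, rfl⟩
      refine ⟨{r | ∃ p ∈ S, ∃ q ∈ T, r = p * q}, ?_, ?_⟩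
      · rintro _ ⟨p, hp, q, hq, rfl⟩
        exact mul_mem (hS hp) (hT hq)
      · ext w
        constructor
        · rintro (h | h) _ ⟨p, hp, q, hq, rfl⟩
          · simp [h p hp]
          · simp [h q hq]
        · intro h
          by_contra hc
          simp only [Set.mem_union, Set.mem_ofPred_eq, not_or, not_forall] at hc
          obtain ⟨⟨p, hp, hpw⟩, ⟨q, hq, hqw⟩⟩ := hc
          exact mul_ne_zero hpw hqw (h _ ⟨p, hp, q, hq, rfl⟩))

/-- The Zariski topology on `GL(V)`, induced from the one on `End(V)`. -/
abbrev zariskiTopologyGL (V : Type u) [AddCommGroup V] [Module K V] :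
    TopologicalSpace (V ≃ₗ[K] V) :=
  (zariskiTopology K (V →ₗ[K] V)).induced fun g => (g : V →ₗ[K] V)

variable {K} {V : Type u} [AddCommGroup V] [Module K V]

/-- For `K` algebraically closed: `B` is a Borel subgroup of the linear algebraic group
`G ≤ GL(V)`, that is, a maximal Zariski closed connected solvable subgroup. -/
def IsBorel (G B : Subgroup (V ≃ₗ[K] V)) : Prop :=
  Maximal (fun H : Subgroup (V ≃ₗ[K] V) => H ≤ G ∧
    @IsClosed _ (zariskiTopologyGL K V) (H : Set (V ≃ₗ[K] V)) ∧
    @IsConnected _ (zariskiTopologyGL K V) (H : Set (V ≃ₗ[K] V)) ∧ Group.IsSolvable H) B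

/-- For `K` algebraically closed: `P` is a parabolic subgroup of `G ≤ GL(V)`, that is, a
Zariski closed subgroup of `G` that contains a Borel subgroup of `G`. -/
def IsParabolic (G P : Subgroup (V ≃ₗ[K] V)) : Prop :=
  P ≤ G ∧ @IsClosed _ (zariskiTopologyGL K V) (P : Set (V ≃ₗ[K] V)) ∧
    ∃ B, IsBorel G B ∧ B ≤ P

/-- A maximal parabolic subgroup: maximal among the proper parabolic subgroups. -/
def IsMaximalParabolic (G P : Subgroup (V ≃ₗ[K] V)) : Prop :=
  Maximal (fun Q : Subgroup (V ≃ₗ[K] V) => IsParabolic G Q ∧ Q ≠ G) P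

end LinearAlgebraicGroup

/-! Everything rests on a few explicit automorphisms, defined over every commutative ring: `SL₃`
acting componentwise, the unipotent elements `expV w` and `expΦ ψ`, and the involution `swap`.

Orbits. A suitable `expV w` normalizes the diagonal of an isotropic vector. Isotropy then reads
`φ(v) = 0`, so `φ` is a cross product `w ∧ v` when `v ≠ 0`, and a second `expV w` removes it.
Traceless vectors thus end in `V₃`, where `SL₃` is transitive on nonzero vectors; vectors scaled to
trace one end at `ε₁`. Automorphisms preserve the trace, so the two kinds of lines stay apart.

Stabilizer of `ε₁`. Preserving the trace turns "fixes the line" into "fixes `ε₁`". Such an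
automorphism preserves `V₃` and its dual, which are cut out by products with `ε₁`. Preserving the
pairing makes the two actions contragredient, and preserving the cross product forces determinant
one (`mem_range_sl3Action`).

Parabolicity. A full `flag` of weight spaces has a solvable stabilizer. The curve `unipotentCurve`
is connected, passes through `1`, preserves the flag and contains a regular unipotent `u`, whose
eigenvectors modulo each step from `flag 1` on lie in the next step. By Lie–Kolchin a connected
solvable subgroup of `G₂` containing `u` has an eigenvector modulo each preserved step, so it
preserves the whole flag (`le_flagGroup`). Hence the identity component of the flag stabilizer is a
Borel subgroup. It fixes the line of `e₁`, because `flag 2` is spanned by `1` and `e₁`.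

Maximality. The stabilizer of this line is even maximal among all abstract subgroups
(`eq_G2_of_lineStabilizer_lt`). An overgroup `Q` contains every element of `G₂` that agrees on `e₁`
with an element of `Q`. Moving a new image of `e₁` by the stabilizer yields an element of `SL₃` in
`Q` off the stabilizer, then all of `SL₃`, all `expV w` and `swap`. So `Q` is transitive on nonzero
traceless isotropic vectors and equals `G₂`. Conjugation carries the result to every other traceless
isotropic line. -/

namespace Zorn

/-- An octonion is determined by its eight coordinates. -/
theorem ext_coord {R : Type u} {x y : Zorn R} (ha : x.a = y.a) (hv₀ : x.v 0 = y.v 0) (hv₁ : x.v 1 = y.v 1)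
    (hv₂ : x.v 2 = y.v 2) (hφ₀ : x.φ 0 = y.φ 0) (hφ₁ : x.φ 1 = y.φ 1) (hφ₂ : x.φ 2 = y.φ 2)
    (hd : x.d = y.d) : x = y := by
  refine Zorn.ext ha ?_ ?_ hd <;> funext i <;> fin_cases i <;> assumption

/-! ### Explicit automorphisms, and the automorphisms fixing `ε₁` -/

section Elements

variable {R : Type u} [CommRing R]

@[simp] theorem one_a : (1 : Zorn R).a = 1 := rfl
@[simp] theorem one_v : (1 : Zorn R).v = 0 := rfl
@[simp] theorem one_φ : (1 : Zorn R).φ = 0 := rfl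
@[simp] theorem one_d : (1 : Zorn R).d = 1 := rfl
@[simp] theorem mul_a (x y : Zorn R) : (x * y).a = x.a * y.a + y.φ ⬝ᵥ x.v := rfl
@[simp] theorem mul_v (x y : Zorn R) :
    (x * y).v = x.a • y.v + y.d • x.v - crossProduct x.φ y.φ := rfl
@[simp] theorem mul_φ (x y : Zorn R) :
    (x * y).φ = y.a • x.φ + x.d • y.φ + crossProduct x.v y.v := rfl
@[simp] theorem mul_d (x y : Zorn R) : (x * y).d = x.φ ⬝ᵥ y.v + x.d * y.d := rfl
@[simp] theorem sub_a (x y : Zorn R) : (x - y).a = x.a - y.a := by simp [sub_eq_add_neg]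
@[simp] theorem sub_v (x y : Zorn R) : (x - y).v = x.v - y.v := by simp [sub_eq_add_neg]
@[simp] theorem sub_φ (x y : Zorn R) : (x - y).φ = x.φ - y.φ := by simp [sub_eq_add_neg]
@[simp] theorem sub_d (x y : Zorn R) : (x - y).d = x.d - y.d := by simp [sub_eq_add_neg]
@[simp] theorem conj_a (x : Zorn R) : (conj x).a = x.d := rfl
@[simp] theorem conj_v (x : Zorn R) : (conj x).v = -x.v := rfl
@[simp] theorem conj_φ (x : Zorn R) : (conj x).φ = -x.φ := rfl
@[simp] theorem conj_d (x : Zorn R) : (conj x).d = x.a := rfl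
@[simp] theorem trace_apply (x : Zorn R) : trace x = x.a + x.d := rfl

theorem mem_V7 {x : Zorn R} : x ∈ V7 R ↔ x.a + x.d = 0 := Iff.rfl

theorem cross_zero (v w : Fin 3 → R) : crossProduct v w 0 = v 1 * w 2 - v 2 * w 1 := by
  simp [cross_apply]

theorem cross_one (v w : Fin 3 → R) : crossProduct v w 1 = v 2 * w 0 - v 0 * w 2 := by
  simp [cross_apply]

theorem cross_two (v w : Fin 3 → R) : crossProduct v w 2 = v 0 * w 1 - v 1 * w 0 := by
  simp [cross_apply]

/-- The unipotent automorphism attached to a vector `w` of `V₃`. -/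
def expV (w : Fin 3 → R) : Zorn R ≃ₗ[R] Zorn R where
  toFun x := ⟨x.a + x.φ ⬝ᵥ w, x.v + (x.d - x.a) • w - (x.φ ⬝ᵥ w) • w,
    x.φ - crossProduct w x.v, x.d - x.φ ⬝ᵥ w⟩
  invFun x := ⟨x.a - x.φ ⬝ᵥ w, x.v - (x.d - x.a) • w - (x.φ ⬝ᵥ w) • w,
    x.φ + crossProduct w x.v, x.d + x.φ ⬝ᵥ w⟩
  map_add' x y := by
    apply ext_coord <;> simp [cross_zero, cross_one, cross_two, Matrix.vec3_dotProduct] <;> ring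
  map_smul' r x := by
    apply ext_coord <;> simp [cross_zero, cross_one, cross_two, Matrix.vec3_dotProduct] <;> ring
  left_inv x := by
    apply ext_coord <;> simp [cross_zero, cross_one, cross_two, Matrix.vec3_dotProduct] <;> ring
  right_inv x := by
    apply ext_coord <;> simp [cross_zero, cross_one, cross_two, Matrix.vec3_dotProduct] <;> ring

@[simp] theorem expV_apply (w : Fin 3 → R) (x : Zorn R) :
    expV w x = ⟨x.a + x.φ ⬝ᵥ w, x.v + (x.d - x.a) • w - (x.φ ⬝ᵥ w) • w,
      x.φ - crossProduct w x.v, x.d - x.φ ⬝ᵥ w⟩ := rfl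

/-- The map is `1 + D + D²/2` for a derivation `D` with `D³ = 0`. The term `D²/2` is `x ↦ -(φ(w))
w`, which needs no division, so the formula is valid over every commutative ring. -/
theorem expV_mem_G2 (w : Fin 3 → R) : expV w ∈ G2 R := by
  refine ⟨?_, fun x => ?_, fun x y => ?_⟩ <;> apply ext_coord <;>
    simp [cross_zero, cross_one, cross_two, Matrix.vec3_dotProduct] <;> ring

/-- The involution that exchanges `V₃` and its dual. -/
def swap : Zorn R ≃ₗ[R] Zorn R where
  toFun x := ⟨x.d, -x.φ, -x.v, x.a⟩
  invFun x := ⟨x.d, -x.φ, -x.v, x.a⟩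
  map_add' x y := by ext <;> simp [add_comm]
  map_smul' r x := by ext <;> simp
  left_inv x := by ext <;> simp
  right_inv x := by ext <;> simp

@[simp] theorem swap_apply (x : Zorn R) : swap x = ⟨x.d, -x.φ, -x.v, x.a⟩ := rfl

theorem swap_mem_G2 : (swap : Zorn R ≃ₗ[R] Zorn R) ∈ G2 R := by
  refine ⟨?_, fun x => ?_, fun x y => ?_⟩ <;> apply ext_coord <;>
    simp [cross_zero, cross_one, cross_two, Matrix.vec3_dotProduct] <;> ring

/-- The unipotent automorphism attached to a linear form `ψ` on `V₃`. -/
def expΦ (ψ : Fin 3 → R) : Zorn R ≃ₗ[R] Zorn R := swap * expV (-ψ) * swap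

theorem expΦ_mem_G2 (ψ : Fin 3 → R) : expΦ ψ ∈ G2 R :=
  mul_mem (mul_mem swap_mem_G2 (expV_mem_G2 _)) swap_mem_G2

@[simp] theorem expΦ_apply (ψ : Fin 3 → R) (x : Zorn R) :
    expΦ ψ x = ⟨x.a - x.v ⬝ᵥ ψ, x.v + crossProduct ψ x.φ,
      x.φ + (x.a - x.d) • ψ - (x.v ⬝ᵥ ψ) • ψ, x.d + x.v ⬝ᵥ ψ⟩ := by
  change swap (expV (-ψ) (swap x)) = _
  apply ext_coord <;> simp [cross_zero, cross_one, cross_two, Matrix.vec3_dotProduct] <;> ring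

theorem sl3Action_apply (A : Matrix.SpecialLinearGroup (Fin 3) R) (x : Zorn R) :
    sl3Action R A x = ⟨x.a, A.1 *ᵥ x.v, (A⁻¹).1ᵀ *ᵥ x.φ, x.d⟩ := rfl

/-- The cofactor matrix is `∧²A` under the identification of `∧²V₃` with the dual of `V₃`. -/
theorem cross_mulVec_mulVec (A : Matrix (Fin 3) (Fin 3) R) (v w : Fin 3 → R) :
    crossProduct (A *ᵥ v) (A *ᵥ w) = A.adjugateᵀ *ᵥ crossProduct v w := by
  funext i
  fin_cases i <;>
    simp [cross_apply, Matrix.mulVec, Matrix.vec3_dotProduct, Matrix.adjugate_fin_three] <;> ring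

theorem inv_transpose_dotProduct (A : Matrix.SpecialLinearGroup (Fin 3) R) (φ v : Fin 3 → R) :
    ((A⁻¹).1ᵀ *ᵥ φ) ⬝ᵥ (A.1 *ᵥ v) = φ ⬝ᵥ v := by
  have h : (A⁻¹).1 * A.1 = 1 := congrArg Subtype.val (inv_mul_cancel A)
  rw [Matrix.mulVec_transpose, ← Matrix.dotProduct_mulVec, Matrix.mulVec_mulVec, h,
    Matrix.one_mulVec]

theorem sl3Action_mem_G2 (A : Matrix.SpecialLinearGroup (Fin 3) R) :
    sl3Action R A ∈ G2 R := by
  have hadj : (A⁻¹).1ᵀ.adjugateᵀ = A.1 := by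
    rw [← Matrix.adjugate_transpose, Matrix.transpose_transpose,
      ← Matrix.SpecialLinearGroup.coe_inv, inv_inv]
  refine ⟨?_, fun x => ?_, fun x y => ?_⟩
  · ext1 <;> simp [sl3Action_apply]
  · ext1 <;> simp [sl3Action_apply, Matrix.mulVec_neg]
  · simp only [sl3Action_apply]
    ext1
    · simp [inv_transpose_dotProduct, -Matrix.SpecialLinearGroup.coe_inv]
    · simp [cross_mulVec_mulVec, hadj, Matrix.mulVec_add, Matrix.mulVec_sub, Matrix.mulVec_smul,
        -Matrix.SpecialLinearGroup.coe_inv]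
    · simp [cross_mulVec_mulVec, Matrix.mulVec_add, Matrix.mulVec_smul]
    · simp [inv_transpose_dotProduct, -Matrix.SpecialLinearGroup.coe_inv]

/-- The trace is determined by the unit and the conjugation through `x + x* = tr(x) • 1`. -/
theorem G2.map_add_conj {g : Zorn R ≃ₗ[R] Zorn R} (hg : g ∈ G2 R) (x : Zorn R) :
    (g x).a + (g x).d = x.a + x.d := by
  have h : x + conj x = (x.a + x.d) • (1 : Zorn R) := by
    ext <;> simp [add_comm]
  have h2 := congrArg (fun z => (g z).a) h
  simpa [hg.2.1, hg.1] using h2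

theorem G2.apply_mem_V7 {g : Zorn R ≃ₗ[R] Zorn R} (hg : g ∈ G2 R) {x : Zorn R} :
    g x ∈ V7 R ↔ x ∈ V7 R := by
  rw [mem_V7, mem_V7, G2.map_add_conj hg]

theorem sl3Action_injective : Function.Injective (sl3Action R) := by
  intro A B h
  ext i j
  have h1 := congrArg Zorn.v (LinearEquiv.congr_fun h ⟨0, Pi.single j 1, 0, 0⟩)
  simpa [sl3Action_apply] using congrFun h1 i

theorem eps1_mul (x : Zorn R) : eps1 R * x = ⟨x.a, x.v, 0, 0⟩ := by
  apply Zorn.ext <;> simp [eps1]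

theorem mul_eps1 (x : Zorn R) : x * eps1 R = ⟨x.a, 0, x.φ, 0⟩ := by
  apply Zorn.ext <;> simp [eps1]

/-- An automorphism that fixes `ε₁` acts through `SL₃`. -/
theorem mem_range_sl3Action {g : Zorn R ≃ₗ[R] Zorn R} (hg : g ∈ G2 R)
    (h : g (eps1 R) = eps1 R) : g ∈ (sl3Action R).range := by
  obtain ⟨g1, g2, g3⟩ := hg
  -- Peirce decomposition: `V₃` is given by `ε₁x = x` and `xε₁ = 0`, its dual by `ε₁x = 0` and `xε₁
  -- = x`. As `g` fixes `ε₁`, it preserves both.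
  have hV (v : Fin 3 → R) : g ⟨0, v, 0, 0⟩ = ⟨0, (g ⟨0, v, 0, 0⟩).v, 0, 0⟩ := by
    have e1 : eps1 R * ⟨0, v, 0, 0⟩ = ⟨0, v, 0, 0⟩ := eps1_mul _
    have e2 : (⟨0, v, 0, 0⟩ : Zorn R) * eps1 R = 0 := mul_eps1 _
    have e3 := congrArg g e1
    have e4 := congrArg g e2
    rw [g3, h, eps1_mul] at e3
    rw [g3, h, mul_eps1, map_zero] at e4
    have e5 := congrArg Zorn.a e4
    simp only [zero_a] at e5
    rw [← e3]
    simp [e5]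
  have hΦ (φ : Fin 3 → R) : g ⟨0, 0, φ, 0⟩ = ⟨0, 0, (g ⟨0, 0, φ, 0⟩).φ, 0⟩ := by
    have e1 : eps1 R * ⟨0, 0, φ, 0⟩ = 0 := eps1_mul _
    have e2 : (⟨0, 0, φ, 0⟩ : Zorn R) * eps1 R = ⟨0, 0, φ, 0⟩ := mul_eps1 _
    have e3 := congrArg g e1
    have e4 := congrArg g e2
    rw [g3, h, eps1_mul, map_zero] at e3
    rw [g3, h, mul_eps1] at e4
    have e5 := congrArg Zorn.a e3
    simp only [zero_a] at e5
    rw [← e4]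
    simp [e5]
  let α : (Fin 3 → R) →ₗ[R] (Fin 3 → R) :=
    { toFun := fun v => (g ⟨0, v, 0, 0⟩).v
      map_add' := fun v w => by
        rw [← add_v, ← map_add]; congr 2; ext <;> simp
      map_smul' := fun r v => by
        rw [RingHom.id_apply, ← smul_v, ← map_smul]; congr 2; ext <;> simp }
  let β : (Fin 3 → R) →ₗ[R] (Fin 3 → R) :=
    { toFun := fun v => (g ⟨0, 0, v, 0⟩).φ
      map_add' := fun v w => by
        rw [← add_φ, ← map_add]; congr 2; ext <;> simp
      map_smul' := fun r v => by
        rw [RingHom.id_apply, ← smul_φ, ← map_smul]; congr 2; ext <;> simp }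
  let A := LinearMap.toMatrix' α
  let B := LinearMap.toMatrix' β
  have hA (v : Fin 3 → R) : g ⟨0, v, 0, 0⟩ = ⟨0, A *ᵥ v, 0, 0⟩ := by
    rw [hV]; simp only [A, LinearMap.toMatrix'_mulVec]; rfl
  have hB (φ : Fin 3 → R) : g ⟨0, 0, φ, 0⟩ = ⟨0, 0, B *ᵥ φ, 0⟩ := by
    rw [hΦ]; simp only [B, LinearMap.toMatrix'_mulVec]; rfl
  have hd : g ⟨0, 0, 0, 1⟩ = ⟨0, 0, 0, 1⟩ := by
    have e : (⟨0, 0, 0, 1⟩ : Zorn R) = 1 - eps1 R := by ext <;> simp [eps1]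
    rw [e, map_sub, g1, h]
  -- The product of `v` and `φ` is `φ(v) ε₁`, so multiplicativity preserves the pairing.
  have hdot (φ v : Fin 3 → R) : (B *ᵥ φ) ⬝ᵥ (A *ᵥ v) = φ ⬝ᵥ v := by
    have e1 := g3 ⟨0, v, 0, 0⟩ ⟨0, 0, φ, 0⟩
    have e2 : (⟨0, v, 0, 0⟩ : Zorn R) * ⟨0, 0, φ, 0⟩ = (φ ⬝ᵥ v) • eps1 R := by
      ext <;> simp [eps1]
    rw [e2, map_smul, h, hA, hB] at e1
    simpa [eps1] using (congrArg Zorn.a e1).symm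
  have hBA : Bᵀ * A = 1 := by
    ext i j
    have := hdot (Pi.single i 1) (Pi.single j 1)
    rw [← Matrix.vecMul_transpose, ← Matrix.dotProduct_mulVec, Matrix.mulVec_mulVec] at this
    simpa [Matrix.one_apply, Pi.single_apply, eq_comm] using this
  have hcross (v w : Fin 3 → R) :
      crossProduct (A *ᵥ v) (A *ᵥ w) = B *ᵥ crossProduct v w := by
    have e1 := g3 ⟨0, v, 0, 0⟩ ⟨0, w, 0, 0⟩
    have e2 : (⟨0, v, 0, 0⟩ : Zorn R) * ⟨0, w, 0, 0⟩ = ⟨0, 0, crossProduct v w, 0⟩ := by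
      ext <;> simp
    rw [e2, hA, hB, hA] at e1
    simpa using (congrArg Zorn.φ e1).symm
  -- Since `∧²A` is the cofactor matrix, applying `Aᵀ` to `Ae₁ ∧ Ae₂ = B(e₁ ∧ e₂)` gives `det A`
  -- times the third basis vector on the left and that vector itself on the right.
  have hdet : A.det = 1 := by
    have e1 := hcross (Pi.single 0 1) (Pi.single 1 1)
    rw [cross_mulVec_mulVec] at e1
    have e2 := congrArg (fun z => Aᵀ *ᵥ z) e1
    simp only [Matrix.mulVec_mulVec] at e2
    rw [← Matrix.transpose_mul, Matrix.adjugate_mul,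
      show Aᵀ * B = 1 by rw [← Matrix.transpose_one, ← hBA, Matrix.transpose_mul,
        Matrix.transpose_transpose]] at e2
    simpa [cross_apply, Matrix.smul_mulVec] using congrFun e2 2
  let A' : Matrix.SpecialLinearGroup (Fin 3) R := ⟨A, hdet⟩
  refine ⟨A', LinearEquiv.ext fun x => ?_⟩
  have hx : x = x.a • eps1 R + ⟨0, x.v, 0, 0⟩ + ⟨0, 0, x.φ, 0⟩ + x.d • ⟨0, 0, 0, 1⟩ := by
    ext <;> simp [eps1]
  have hinv : (A'⁻¹).1ᵀ = B := by
    rw [Matrix.SpecialLinearGroup.coe_inv]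
    have e1 : A * A.adjugate = 1 := by rw [Matrix.mul_adjugate, hdet, one_smul]
    have e2 : A.adjugate = Bᵀ := by
      rw [← one_mul A.adjugate, ← hBA, mul_assoc, e1, mul_one]
    change A.adjugateᵀ = B
    rw [e2, Matrix.transpose_transpose]
  conv_rhs => rw [hx]
  rw [map_add, map_add, map_add, map_smul, map_smul, h, hA, hB, hd, sl3Action_apply, hinv]
  ext1 <;> simp [eps1, A']

end Elements

/-! ### The stabilizer of the line of `ε₁` as a group functor -/

section Stabilizer

variable {F : Type u} [Field F] {R : Type u} [CommRing R] [Algebra F R]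

/-- Extension of scalars as a semilinear map. -/
def mapₗ (R : Type u) [CommRing R] [Algebra F R] : Zorn F →ₛₗ[algebraMap F R] Zorn R where
  toFun := map R
  map_add' x y := by ext <;> simp [map]
  map_smul' c x := by ext <;> simp [map]

theorem baseChange_span_singleton (x : Zorn F) :
    baseChange R (Submodule.span F {x}) = Submodule.span R {map R x} := by
  apply le_antisymm
  · refine Submodule.span_le.2 ?_
    rintro _ ⟨y, hy, rfl⟩
    obtain ⟨c, rfl⟩ := Submodule.mem_span_singleton.1 hy
    exact Submodule.mem_span_singleton.2 ⟨algebraMap F R c, ((mapₗ R).map_smulₛₗ c x).symm⟩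
  · exact Submodule.span_mono (Set.singleton_subset_iff.2 ⟨x, Submodule.mem_span_singleton_self x, rfl⟩)

theorem map_eps1 : map R (eps1 F) = eps1 R := by
  ext <;> simp [map, eps1]

theorem smul_span_singleton (g : Zorn R ≃ₗ[R] Zorn R) (x : Zorn R) :
    g • Submodule.span R {x} = Submodule.span R {g x} := by
  rw [Submodule.smul_span, Set.smul_set_singleton]
  rfl

theorem range_sl3Action_eq_stabilizerPoints :
    (sl3Action R).range = stabilizerPoints (Submodule.span F {eps1 F}) R := by
  apply le_antisymm
  · rintro _ ⟨A, rfl⟩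
    refine ⟨sl3Action_mem_G2 A, ?_⟩
    change _ ∈ MulAction.stabilizer _ _
    rw [MulAction.mem_stabilizer_iff, baseChange_span_singleton, map_eps1,
      smul_span_singleton]
    congr 2
    ext <;> simp [sl3Action_apply, eps1]
  · rintro g ⟨hg, hs⟩
    change _ ∈ MulAction.stabilizer _ _ at hs
    rw [MulAction.mem_stabilizer_iff, baseChange_span_singleton, map_eps1,
      smul_span_singleton] at hs
    refine mem_range_sl3Action hg ?_
    have h1 : g (eps1 R) ∈ Submodule.span R {eps1 R} := hs ▸ Submodule.mem_span_singleton_self _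
    obtain ⟨c, hc⟩ := Submodule.mem_span_singleton.1 h1
    -- The scalar `c` is the trace of `c • ε₁`, hence equal to the trace of `ε₁`, which is `1`.
    have h2 := G2.map_add_conj hg (eps1 R)
    rw [← hc] at h2 ⊢
    have h3 : c = 1 := by simpa [eps1] using h2
    rw [h3, one_smul]

end Stabilizer
end Zorn

/-! ### Orbits on isotropic lines -/

namespace Zorn

section Field

variable {F : Type u} [Field F]

/-- The octonion with a single component `v` in `V₃`. -/
def ofV (v : Fin 3 → F) : Zorn F := ⟨0, v, 0, 0⟩

/-- The octonion with a single component `φ` in the dual of `V₃`. -/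
def ofΦ (φ : Fin 3 → F) : Zorn F := ⟨0, 0, φ, 0⟩

/-- The first basis vector of `V₃`. -/
def e₁ : Zorn F := ofV (Pi.single 0 1)

theorem sl3Action_ofV (A : Matrix.SpecialLinearGroup (Fin 3) F) (v : Fin 3 → F) :
    sl3Action F A (ofV v) = ofV (A.1 *ᵥ v) := by
  ext1 <;> simp [sl3Action_apply, ofV]

theorem sl3Action_ofΦ (A : Matrix.SpecialLinearGroup (Fin 3) F) (φ : Fin 3 → F) :
    sl3Action F A (ofΦ φ) = ofΦ ((A⁻¹).1ᵀ *ᵥ φ) := by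
  ext1 <;> simp [sl3Action_apply, ofΦ]

theorem ofV_smul (c : F) (v : Fin 3 → F) : ofV (c • v) = c • ofV v := by
  ext <;> simp [ofV]

theorem norm_apply_of_mem_G2 {g : Zorn F ≃ₗ[F] Zorn F} (hg : g ∈ G2 F) (x : Zorn F) :
    norm (g x) = norm x := norm_map ⟨g, hg⟩ x

/-- The map `w ↦ w ∧ v` has the line of `v` as its kernel, so its image is the whole plane
orthogonal to `v`. The witnesses divide by a nonzero coordinate of `v`. -/
theorem exists_cross_eq {v φ : Fin 3 → F} (hv : v ≠ 0) (h : φ ⬝ᵥ v = 0) :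
    ∃ w, crossProduct w v = φ := by
  rw [Matrix.vec3_dotProduct] at h
  have key : v 0 ≠ 0 ∨ v 1 ≠ 0 ∨ v 2 ≠ 0 := by
    by_contra! hc
    exact hv (by funext i; fin_cases i <;> simp [hc])
  rcases key with h0 | h0 | h0
  · refine ⟨![0, -φ 2 / v 0, φ 1 / v 0], ?_⟩
    funext i
    fin_cases i <;> simp [cross_zero, cross_one, cross_two] <;> field_simp
    linear_combination -h
  · refine ⟨![φ 2 / v 1, 0, -φ 0 / v 1], ?_⟩
    funext i
    fin_cases i <;> simp [cross_zero, cross_one, cross_two] <;> field_simp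
    linear_combination -h
  · refine ⟨![-φ 1 / v 2, φ 0 / v 2, 0], ?_⟩
    funext i
    fin_cases i <;> simp [cross_zero, cross_one, cross_two] <;> field_simp
    linear_combination -h

theorem exists_dotProduct_eq {φ : Fin 3 → F} (hφ : φ ≠ 0) (c : F) : ∃ w, φ ⬝ᵥ w = c := by
  obtain ⟨i, hi⟩ := Function.ne_iff.1 hφ
  exact ⟨Pi.single i ((φ i)⁻¹ * c), by simpa using mul_inv_cancel_left₀ hi c⟩

/-- `SL₃` moves `(e₁, e₂)` to `(e₁, v)` if `v` is not a multiple of `e₁`. -/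
theorem exists_sl3_of_ne {v : Fin 3 → F} (hv : v 1 ≠ 0 ∨ v 2 ≠ 0) :
    ∃ A : Matrix.SpecialLinearGroup (Fin 3) F,
      A.1 *ᵥ Pi.single 0 1 = Pi.single 0 1 ∧ A.1 *ᵥ Pi.single 1 1 = v := by
  rcases hv with h | h
  · refine ⟨⟨!![1, v 0, 0; 0, v 1, 0; 0, v 2, (v 1)⁻¹], ?_⟩, ?_, ?_⟩
    · simp [Matrix.det_fin_three, h]
    · funext i; fin_cases i <;> simp
    · funext i; fin_cases i <;> simp
  · refine ⟨⟨!![1, v 0, 0; 0, v 1, -(v 2)⁻¹; 0, v 2, 0], ?_⟩, ?_, ?_⟩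
    · simp [Matrix.det_fin_three, h]
    · funext i; fin_cases i <;> simp
    · funext i; fin_cases i <;> simp

theorem exists_sl3_apply_eq {v : Fin 3 → F} (hv : v ≠ 0) :
    ∃ A : Matrix.SpecialLinearGroup (Fin 3) F, A.1 *ᵥ Pi.single 0 1 = v := by
  by_cases h : v 1 ≠ 0 ∨ v 2 ≠ 0
  · obtain ⟨A, -, hA⟩ := exists_sl3_of_ne h
    -- The previous lemma reaches `v` from `e₂`; a quarter turn takes `e₁` to `e₂` first.
    let W : Matrix.SpecialLinearGroup (Fin 3) F :=
      ⟨!![0, -1, 0; 1, 0, 0; 0, 0, 1], by simp [Matrix.det_fin_three]⟩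
    refine ⟨A * W, ?_⟩
    rw [Matrix.SpecialLinearGroup.coe_mul, ← Matrix.mulVec_mulVec, ← hA]
    congr 1
    funext i; fin_cases i <;> simp [W]
  · push Not at h
    have h0 : v 0 ≠ 0 := fun h0 => hv (by funext i; fin_cases i <;> simp [h0, h])
    refine ⟨⟨!![v 0, 0, 0; 0, (v 0)⁻¹, 0; 0, 0, 1], by simp [Matrix.det_fin_three, h0]⟩, ?_⟩
    funext i; fin_cases i <;> simp [h]

/-- A group that contains the standard unipotent elements and the involution moves each
traceless isotropic octonion into `V₃`. -/
theorem exists_apply_eq_ofV {Q : Subgroup (Zorn F ≃ₗ[F] Zorn F)} (hE : ∀ w, expV w ∈ Q)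
    (hs : swap ∈ Q) {x : Zorn F} (hx : x ≠ 0) (ht : x ∈ V7 F) (hn : norm x = 0) :
    ∃ g ∈ Q, ∃ v ≠ 0, g x = ofV v := by
  have step1 (v φ : Fin 3 → F) (hx : (⟨0, v, φ, 0⟩ : Zorn F) ≠ 0) (h : φ ⬝ᵥ v = 0) :
      ∃ g ∈ Q, ∃ v' ≠ 0, g ⟨0, v, φ, 0⟩ = ofV v' := by
    by_cases hv : v = 0
    · subst hv
      refine ⟨swap, hs, -φ, ?_, ?_⟩
      · rintro h0
        rw [neg_eq_zero] at h0
        exact hx (by rw [h0]; rfl)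
      · ext <;> simp [ofV]
    -- On zero diagonal `expV w` subtracts `w ∧ v` from the dual part, and it leaves `v` alone
    -- because `(w ∧ v)(w) = 0`.
    · obtain ⟨w, rfl⟩ := exists_cross_eq hv h
      refine ⟨expV w, hE w, v, hv, ?_⟩
      have h0 : crossProduct w v ⬝ᵥ w = 0 := by
        rw [dotProduct_comm]; exact dot_self_cross w v
      ext1 <;> simp [ofV, h0]
  rw [mem_V7] at ht
  have hd : x.d = -x.a := by linear_combination ht
  by_cases hφ : x.φ = 0
  · have ha : x.a = 0 := by simpa [norm, hφ, hd] using hn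
    refine ⟨1, one_mem _, x.v, ?_, ?_⟩
    · intro hv
      exact hx (by ext <;> simp [hφ, hd, ha, hv])
    · ext1 <;> simp [ofV, hφ, hd, ha]
  -- `expV w` adds `φ(w) = -a` to the entry `a` and subtracts it from `d = -a`, so both vanish.
  · obtain ⟨w, hw⟩ := exists_dotProduct_eq hφ (-x.a)
    have h1 : expV w x = ⟨0, (expV w x).v, (expV w x).φ, 0⟩ := by
      ext1 <;> simp [hw, hd]
    have h2 : norm (expV w x) = 0 := by rw [norm_apply_of_mem_G2 (expV_mem_G2 w), hn]
    have h3 : (expV w x).φ ⬝ᵥ (expV w x).v = 0 := by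
      rw [h1] at h2
      simpa only [norm, zero_mul, zero_sub, neg_eq_zero] using h2
    have h4 : (⟨0, (expV w x).v, (expV w x).φ, 0⟩ : Zorn F) ≠ 0 := by
      rw [← h1]; simpa only [ne_eq, LinearEquiv.map_eq_zero_iff] using hx
    obtain ⟨g, hg, v, hv, h5⟩ := step1 _ _ h4 h3
    refine ⟨g * expV w, mul_mem hg (hE w), v, hv, ?_⟩
    rw [← h5, ← h1]
    rfl

/-- The group `Q` is left general because the statement serves twice: for `G₂` in the orbit count,
and for an overgroup of the line stabilizer in the proof of maximality. -/
theorem exists_apply_e₁_eq {Q : Subgroup (Zorn F ≃ₗ[F] Zorn F)} (hE : ∀ w, expV w ∈ Q)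
    (hs : swap ∈ Q) (hA : ∀ A, sl3Action F A ∈ Q) {x : Zorn F} (hx : x ≠ 0) (ht : x ∈ V7 F)
    (hn : norm x = 0) : ∃ g ∈ Q, g e₁ = x := by
  obtain ⟨g, hg, v, hv, h⟩ := exists_apply_eq_ofV hE hs hx ht hn
  obtain ⟨A, rfl⟩ := exists_sl3_apply_eq hv
  refine ⟨g⁻¹ * sl3Action F A, mul_mem (inv_mem hg) (hA A), ?_⟩
  change g.symm (sl3Action F A e₁) = x
  rw [LinearEquiv.symm_apply_eq, h, e₁, sl3Action_ofV]

theorem exists_G2_apply_e₁_eq {x : Zorn F} (hx : x ≠ 0) (ht : x ∈ V7 F) (hn : norm x = 0) :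
    ∃ g ∈ G2 F, g e₁ = x :=
  exists_apply_e₁_eq expV_mem_G2 swap_mem_G2 sl3Action_mem_G2 hx ht hn

/-- Idempotents of trace one are conjugate to `ε₁`. -/
theorem exists_G2_apply_eq_eps1 {x : Zorn F} (ht : x.a + x.d = 1) (hn : norm x = 0) :
    ∃ g ∈ G2 F, g x = eps1 F := by
  have back {x : Zorn F} (h : Zorn F ≃ₗ[F] Zorn F) (hh : h ∈ G2 F)
      (H : ∃ g ∈ G2 F, g (h x) = eps1 F) : ∃ g ∈ G2 F, g x = eps1 F := by
    obtain ⟨g, hg, e⟩ := H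
    exact ⟨g * h, mul_mem hg hh, e⟩
  have step1 (v : Fin 3 → F) : ∃ g ∈ G2 F, g ⟨1, v, 0, 0⟩ = eps1 F := by
    refine ⟨expV v, expV_mem_G2 v, ?_⟩
    ext1 <;> simp [eps1]
  have step2 (v : Fin 3 → F) : ∃ g ∈ G2 F, g ⟨0, v, 0, 1⟩ = eps1 F := by
    refine back (expV (-v)) (expV_mem_G2 _) ⟨swap, swap_mem_G2, ?_⟩
    ext1 <;> simp [eps1]
  have step3 (v φ : Fin 3 → F) (h : φ ⬝ᵥ v = 0) : ∃ g ∈ G2 F, g ⟨0, v, φ, 1⟩ = eps1 F := by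
    by_cases hv : v = 0
    · subst hv
      refine back swap swap_mem_G2 ?_
      convert step1 (-φ) using 4
      ext1 <;> simp
    · obtain ⟨w, rfl⟩ := exists_cross_eq hv h
      refine back (expV w) (expV_mem_G2 w) ?_
      have h0 : crossProduct w v ⬝ᵥ w = 0 := by
        rw [dotProduct_comm]; exact dot_self_cross w v
      convert step2 (v + w) using 4
      ext1 <;> simp [h0]
  have hd : x.d = 1 - x.a := by linear_combination ht
  by_cases hφ : x.φ = 0
  · have ha : x.a * (1 - x.a) = 0 := by simpa [norm, hφ, hd] using hn
    rcases mul_eq_zero.1 ha with ha | ha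
    · rw [show x = ⟨0, x.v, 0, 1⟩ by ext1 <;> simp [ha, hd, hφ]]
      exact step2 x.v
    · have ha' : x.a = 1 := by linear_combination -ha
      rw [show x = ⟨1, x.v, 0, 0⟩ by ext1 <;> simp [ha', hd, hφ]]
      exact step1 x.v
  · obtain ⟨w, hw⟩ := exists_dotProduct_eq hφ (-x.a)
    have h1 : expV w x = ⟨0, (expV w x).v, (expV w x).φ, 1⟩ := by
      ext1 <;> simp [hw, hd]
    have h2 : norm (expV w x) = 0 := by rw [norm_apply_of_mem_G2 (expV_mem_G2 w), hn]
    have h3 : (expV w x).φ ⬝ᵥ (expV w x).v = 0 := by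
      rw [h1] at h2
      simpa only [norm, zero_mul, zero_sub, neg_eq_zero] using h2
    refine back (expV w) (expV_mem_G2 w) ?_
    rw [h1]
    exact step3 _ _ h3

namespace IsotropicLine

theorem exists_eq_span (ℓ : IsotropicLine F) :
    ∃ x : Zorn F, x ≠ 0 ∧ norm x = 0 ∧ ℓ.line = Submodule.span F {x} := by
  obtain ⟨x, hx, h⟩ := finrank_eq_one_iff'.1 ℓ.finrank_eq_one
  refine ⟨x, by simpa using hx, ℓ.norm_eq_zero _ x.2, le_antisymm (fun y hy => ?_) ?_⟩
  · obtain ⟨c, hc⟩ := h ⟨y, hy⟩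
    exact Submodule.mem_span_singleton.2 ⟨c, congrArg Subtype.val hc⟩
  · simp

theorem norm_smul (c : F) (x : Zorn F) : norm (c • x) = c ^ 2 * norm x := by
  simp [norm]; ring

/-- The line spanned by a nonzero isotropic vector. -/
def mk' (x : Zorn F) (hx : x ≠ 0) (hn : norm x = 0) : IsotropicLine F where
  line := Submodule.span F {x}
  finrank_eq_one := finrank_span_singleton hx
  norm_eq_zero y hy := by
    obtain ⟨c, rfl⟩ := Submodule.mem_span_singleton.1 hy
    rw [norm_smul, hn, mul_zero]

theorem smul_line (g : G2 F) (ℓ : IsotropicLine F) : (g • ℓ).line = g.1 • ℓ.line := rfl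

theorem span_le_V7 {x : Zorn F} : Submodule.span F {x} ≤ V7 F ↔ x ∈ V7 F := by simp

theorem smul_le_V7 (g : G2 F) (ℓ : IsotropicLine F) : (g • ℓ).line ≤ V7 F ↔ ℓ.line ≤ V7 F := by
  obtain ⟨x, -, -, h⟩ := ℓ.exists_eq_span
  rw [smul_line, h, smul_span_singleton, span_le_V7, span_le_V7, G2.apply_mem_V7 g.2]

theorem ofV_ne_zero {v : Fin 3 → F} (hv : v ≠ 0) : ofV v ≠ 0 :=
  fun h => hv (congrArg Zorn.v h)

theorem norm_ofV (v : Fin 3 → F) : norm (ofV v) = 0 := by simp [norm, ofV]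

theorem ofV_mem_V7 (v : Fin 3 → F) : ofV v ∈ V7 F := by simp [mem_V7, ofV]

/-- The isotropic line through a nonzero vector of `V₃`. -/
def lineV (v : Fin 3 → F) (hv : v ≠ 0) : IsotropicLine F := mk' (ofV v) (ofV_ne_zero hv) (norm_ofV v)

theorem single_ne_zero : (Pi.single 0 1 : Fin 3 → F) ≠ 0 := by simp

/-- The isotropic line through `ε₁`. -/
def lineEps1 : IsotropicLine F :=
  mk' (eps1 F) (fun h => one_ne_zero (congrArg Zorn.a h)) (by simp [norm, eps1])

theorem lineEps1_not_le : ¬ (lineEps1 : IsotropicLine F).line ≤ V7 F := by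
  change ¬ Submodule.span F {_} ≤ _
  rw [span_le_V7, mem_V7]
  simp [eps1]

theorem lineV_le (v : Fin 3 → F) (hv : v ≠ 0) : (lineV v hv).line ≤ V7 F :=
  span_le_V7.2 (ofV_mem_V7 v)

theorem mem_orbit_of_le {ℓ : IsotropicLine F} (h : ℓ.line ≤ V7 F) :
    ℓ ∈ MulAction.orbit (G2 F) (lineV (Pi.single 0 1) single_ne_zero : IsotropicLine F) := by
  obtain ⟨x, hx, hn, e⟩ := ℓ.exists_eq_span
  rw [e, span_le_V7] at h
  obtain ⟨g, hg, hgx⟩ := exists_G2_apply_e₁_eq hx h hn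
  refine ⟨⟨g, hg⟩, IsotropicLine.ext ?_⟩
  rw [e, ← hgx]
  exact smul_span_singleton g _

theorem mem_orbit_of_not_le {ℓ : IsotropicLine F} (h : ¬ ℓ.line ≤ V7 F) :
    ℓ ∈ MulAction.orbit (G2 F) (lineEps1 : IsotropicLine F) := by
  obtain ⟨x, hx, hn, e⟩ := ℓ.exists_eq_span
  rw [e, span_le_V7, mem_V7] at h
  -- An isotropic line outside `V₇` contains a vector of trace one, which is an idempotent.
  have ht : ((x.a + x.d)⁻¹ • x).a + ((x.a + x.d)⁻¹ • x).d = 1 := by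
    rw [smul_a, smul_d, ← mul_add, inv_mul_cancel₀ h]
  obtain ⟨g, hg, hgx⟩ := exists_G2_apply_eq_eps1 ht (by rw [norm_smul, hn, mul_zero])
  rw [MulAction.mem_orbit_symm]
  refine ⟨⟨g, hg⟩, IsotropicLine.ext ?_⟩
  change g • ℓ.line = Submodule.span F {eps1 F}
  rw [e, smul_span_singleton, ← hgx, map_smul, Submodule.span_singleton_smul_eq (by simpa using h)]

theorem mem_orbit_iff (ℓ ℓ' : IsotropicLine F) :
    ℓ' ∈ MulAction.orbit (G2 F) ℓ ↔ (ℓ.line ≤ V7 F ↔ ℓ'.line ≤ V7 F) := by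
  constructor
  · rintro ⟨g, rfl⟩
    exact (smul_le_V7 g ℓ).symm
  · intro h
    by_cases hℓ : ℓ.line ≤ V7 F
    · have h1 := mem_orbit_of_le (h.1 hℓ)
      rwa [← MulAction.orbit_eq_iff.2 (mem_orbit_of_le hℓ)] at h1
    · have h1 := mem_orbit_of_not_le (fun h' => hℓ (h.2 h'))
      rwa [← MulAction.orbit_eq_iff.2 (mem_orbit_of_not_le hℓ)] at h1

/-- Tracelessness descends to a bijection from the set of orbits onto `Prop`, which has two
elements. -/
theorem card_orbits :
    Nat.card (MulAction.orbitRel.Quotient (G2 F) (IsotropicLine F)) = 2 := by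
  let f : MulAction.orbitRel.Quotient (G2 F) (IsotropicLine F) → Prop :=
    Quotient.lift (fun ℓ => ℓ.line ≤ V7 F) fun ℓ ℓ' h =>
      propext ((mem_orbit_iff ℓ' ℓ).1 h).symm
  have hf : Function.Bijective f := by
    constructor
    · rintro ⟨ℓ⟩ ⟨ℓ'⟩ h
      exact Quotient.sound ((mem_orbit_iff ℓ' ℓ).2 (iff_of_eq h.symm))
    · intro p
      by_cases hp : p
      · exact ⟨Quotient.mk _ (lineV (Pi.single 0 1) single_ne_zero),
          propext ⟨fun _ => hp, fun _ => lineV_le _ _⟩⟩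
      · exact ⟨Quotient.mk _ lineEps1,
          propext ⟨fun h => absurd h lineEps1_not_le, fun h => absurd h hp⟩⟩
  rw [Nat.card_congr (Equiv.ofBijective f hf)]
  simp

end IsotropicLine

end Field
end Zorn

/-! ### The Lie–Kolchin theorem -/

section LieKolchin

open Module
open scoped commutatorElement

theorem exists_eigenvector_mem {K V : Type*} [Field K] [IsAlgClosed K] [AddCommGroup V] [Module K V]
    [FiniteDimensional K V] {W : Submodule K V} (hW : W ≠ ⊥) (s : End K V)
    (hs : ∀ w ∈ W, s w ∈ W) : ∃ w ∈ W, w ≠ 0 ∧ ∃ c : K, s w = c • w := by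
  have := Submodule.nontrivial_iff_ne_bot.2 hW
  obtain ⟨c, hc⟩ := Module.End.exists_eigenvalue (s.restrict hs)
  obtain ⟨w, hw⟩ := hc.exists_hasEigenvector
  exact ⟨w, w.2, by simpa using hw.2, c, congrArg Subtype.val hw.apply_eq_smul⟩

/-- A commuting family of endomorphisms has a common eigenvector. -/
theorem exists_common_eigenvector_of_commute {K V : Type*} [Field K] [IsAlgClosed K]
    [AddCommGroup V] [Module K V] [FiniteDimensional K V] (S : Set (End K V))
    {W : Submodule K V} (hW : W ≠ ⊥) (hS : ∀ s ∈ S, ∀ w ∈ W, s w ∈ W)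
    (hcomm : ∀ s ∈ S, ∀ t ∈ S, ∀ w ∈ W, s (t w) = t (s w)) :
    ∃ w ∈ W, w ≠ 0 ∧ ∀ s ∈ S, ∃ c : K, s w = c • w := by
  induction hn : finrank K W using Nat.strong_induction_on generalizing W with
  | _ n ih =>
    obtain ⟨w₀, hw₀, hne⟩ := Submodule.exists_mem_ne_zero_of_ne_bot hW
    by_cases hall : ∀ s ∈ S, ∃ c : K, s w₀ = c • w₀
    · exact ⟨w₀, hw₀, hne, hall⟩
    push Not at hall
    obtain ⟨s, hs, hsc⟩ := hall
    obtain ⟨w₁, hw₁, hne₁, c, hc⟩ := exists_eigenvector_mem hW s (hS s hs)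
    -- The eigenspace of a nonscalar `s` in `W` is nonzero and smaller than `W`, and the whole
    -- family preserves it because it commutes with `s`.
    let W' : Submodule K V := W ⊓ LinearMap.ker (s - c • LinearMap.id)
    have mem_W' {w : V} : w ∈ W' ↔ w ∈ W ∧ s w = c • w := by
      simp [W', sub_eq_zero]
    have hlt : W' < W := by
      refine lt_of_le_of_ne inf_le_left fun h => ?_
      rw [← h] at hw₀
      exact hsc c (mem_W'.1 hw₀).2
    obtain ⟨w, hw, h⟩ := ih (finrank K W') (hn ▸ Submodule.finrank_lt_finrank_of_lt hlt)
      (W := W') (fun h => hne₁ (by simpa [h] using mem_W'.2 ⟨hw₁, hc⟩))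
      (fun t ht w hw => mem_W'.2 ⟨hS t ht w (mem_W'.1 hw).1, by
        rw [hcomm s hs t ht w (mem_W'.1 hw).1, (mem_W'.1 hw).2, map_smul]⟩)
      (fun t ht t' ht' w hw => hcomm t ht t' ht' w (mem_W'.1 hw).1) rfl
    exact ⟨w, (mem_W'.1 hw).1, h⟩

variable {Γ : Type*} [Group Γ] [TopologicalSpace Γ]

/-- A subgroup generated by a union of connected sets through `1` is connected. -/
theorem isConnected_closure_of_isConnected (hmul : ∀ h : Γ, Continuous fun g => h * g)
    {S : Set Γ} (hS : ∀ s ∈ S, s⁻¹ ∈ S)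
    (hconn : ∀ s ∈ S, ∃ T ⊆ S, IsPreconnected T ∧ 1 ∈ T ∧ s ∈ T) :
    IsConnected (Subgroup.closure S : Set Γ) := by
  set D := Subgroup.closure S
  suffices h : (D : Set Γ) ⊆ connectedComponentIn D 1 by
    rw [Set.Subset.antisymm h (connectedComponentIn_subset _ _)]
    exact isConnected_connectedComponentIn_iff.2 (one_mem D)
  have hstep (x : Γ) (hx : x ∈ D) (y : Γ) (hy : y ∈ S)
      (hxc : x ∈ connectedComponentIn (D : Set Γ) 1) :
      x * y ∈ connectedComponentIn (D : Set Γ) 1 := by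
    obtain ⟨T, hTS, hT, h1, hyT⟩ := hconn y hy
    rw [connectedComponentIn_eq hxc]
    refine (hT.image (fun g => x * g) (hmul x).continuousOn).subset_connectedComponentIn
      ⟨1, h1, mul_one x⟩ ?_ ⟨y, hyT, rfl⟩
    rintro _ ⟨t, ht, rfl⟩
    exact mul_mem hx (Subgroup.subset_closure (hTS ht))
  intro x hx
  induction hx using Subgroup.closure_induction_right with
  | one => exact mem_connectedComponentIn (one_mem D)
  | mul_right x hx y hy ih => exact hstep x hx y hy ih
  | mul_inv_cancel x hx y hy ih => exact hstep x hx _ (hS y hy) ih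

/-- For fixed `h` the commutators `⁅g, h⁆` form a connected set through `1`. Continuity is asked in
one variable at a time, since the Zariski topology does not make a group a topological group. -/
theorem isConnected_commutator (hmul : ∀ h : Γ, Continuous fun g => h * g)
    (hcomm : ∀ h : Γ, Continuous fun g => g * h * g⁻¹ * h⁻¹) {G : Subgroup Γ}
    (hG : IsConnected (G : Set Γ)) : IsConnected ((⁅G, G⁆ : Subgroup Γ) : Set Γ) := by
  have e : ⁅G, G⁆ = Subgroup.closure {x | ∃ g ∈ G, ∃ h ∈ G, ⁅g, h⁆ = x} := rfl
  rw [e]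
  refine isConnected_closure_of_isConnected hmul ?_ ?_
  · rintro _ ⟨g, hg, h, hh, rfl⟩
    exact ⟨h, hh, g, hg, (commutatorElement_inv g h).symm⟩
  · rintro _ ⟨g, hg, h, hh, rfl⟩
    refine ⟨(fun g => g * h * g⁻¹ * h⁻¹) '' G, ?_, hG.isPreconnected.image _ (hcomm h).continuousOn,
      ⟨1, one_mem G, by simp⟩, ⟨g, hg, rfl⟩⟩
    rintro _ ⟨g', hg', rfl⟩
    exact ⟨g', hg', h, hh, rfl⟩

theorem isConnected_derivedSeries [ConnectedSpace Γ] (hmul : ∀ h : Γ, Continuous fun g => h * g)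
    (hcomm : ∀ h : Γ, Continuous fun g => g * h * g⁻¹ * h⁻¹) (n : ℕ) :
    IsConnected (derivedSeries Γ n : Set Γ) := by
  induction n with
  | zero => simpa using isConnected_univ
  | succ n ih => exact isConnected_commutator hmul hcomm ih

variable {K V : Type*} [Field K] [AddCommGroup V] [Module K V] [FiniteDimensional K V]

/-- If `T` acts on each vector of a connected orbit of nonzero vectors by a scalar, then it acts
by one and the same scalar on the whole orbit. -/
theorem eq_smul_of_isPreconnected {ρ : Γ →* End K V}
    (hρ : ∀ (f : Dual K V) (w : V), IsClosed {g | f (ρ g w) = 0}) {S : Set Γ}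
    (hS : IsPreconnected S) {w : V} (hw : w ≠ 0) (T : End K V)
    (hT : ∀ g ∈ S, ∃ c : K, T (ρ g w) = c • ρ g w) {g₀ : Γ} (hg₀ : g₀ ∈ S) {c₀ : K}
    (hc₀ : T (ρ g₀ w) = c₀ • ρ g₀ w) : ∀ g ∈ S, T (ρ g w) = c₀ • ρ g w := by
  have hne (g : Γ) : ρ g w ≠ 0 := by
    intro h
    apply hw
    have : ρ g⁻¹ (ρ g w) = w := by rw [← Module.End.mul_apply, ← map_mul]; simp
    rw [← this, h, map_zero]
  -- These sets are closed and pairwise disjoint, and finitely many of them, one for each eigenvalue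
  -- of `T`, cover `S`. A connected `S` lies in a single one.
  let Z (c : K) : Set Γ := {g | T (ρ g w) = c • ρ g w}
  have hZ (c : K) : IsClosed (Z c) := by
    have e : Z c = ⋂ f : Dual K V, {g | (f ∘ₗ (T - c • LinearMap.id)) (ρ g w) = 0} := by
      ext g
      simp only [Set.mem_iInter, Set.mem_ofPred_eq, LinearMap.comp_apply]
      rw [Module.forall_dual_apply_eq_zero_iff]
      simp [Z, sub_eq_zero]
    rw [e]
    exact isClosed_iInter fun f => hρ _ w
  have hfin : {c : K | T.HasEigenvalue c}.Finite := Module.End.finite_hasEigenvalue T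
  have hunion : IsClosed (⋃ c ∈ {c : K | T.HasEigenvalue c} \ {c₀}, Z c) :=
    (hfin.subset Set.sdiff_subset).isClosed_biUnion fun c _ => hZ c
  have hdisj (c : K) (g : Γ) (h : g ∈ Z c) (h₀ : g ∈ Z c₀) : c = c₀ := by
    have : T (ρ g w) = c • ρ g w := h
    have h' : T (ρ g w) = c₀ • ρ g w := h₀
    exact smul_left_injective K (hne g) (this.symm.trans h')
  have hcover : S ⊆ Z c₀ ∪ ⋃ c ∈ {c : K | T.HasEigenvalue c} \ {c₀}, Z c := by
    intro g hg
    obtain ⟨c, hc⟩ := hT g hg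
    by_cases h : c = c₀
    · exact Or.inl (h ▸ hc)
    · exact Or.inr (Set.mem_iUnion₂.2 ⟨c, ⟨Module.End.hasEigenvalue_of_hasEigenvector
        (x := ρ g w) ⟨Module.End.mem_eigenspace_iff.2 hc, hne g⟩, h⟩, hc⟩)
  have hempty : S ∩ (Z c₀ ∩ ⋃ c ∈ {c : K | T.HasEigenvalue c} \ {c₀}, Z c) = ∅ := by
    rw [Set.eq_empty_iff_forall_notMem]
    rintro g ⟨-, h₀, h⟩
    obtain ⟨c, hc, h'⟩ := Set.mem_iUnion₂.1 h
    exact hc.2 (hdisj c g h' h₀)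
  rcases isPreconnected_iff_subset_of_disjoint_closed.1 hS _ _ (hZ c₀) hunion hcover hempty
    with h | h
  · exact fun g hg => h hg
  · obtain ⟨c, hc, h'⟩ := Set.mem_iUnion₂.1 (h hg₀)
    exact absurd (hdisj c g₀ h' hc₀) hc.2

variable [IsAlgClosed K]

/-- Inductive step of Lie–Kolchin. The vectors on which the commutator subgroup acts through the
same scalars `χ` as on `w₀` form a space `W`. Connectedness of `G` keeps `χ` constant under
conjugation, so `G` preserves `W`; there commutators act trivially, and the commuting case applies.
-/
theorem exists_common_eigenvector_of_commutator {ρ : Γ →* End K V}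
    (hρ : ∀ (f : Dual K V) (w : V), IsClosed {g | f (ρ g w) = 0}) {G : Subgroup Γ}
    (hG : IsConnected (G : Set Γ)) {w₀ : V} (hw₀ : w₀ ≠ 0)
    (h₀ : ∀ g ∈ ⁅G, G⁆, ∃ c : K, ρ g w₀ = c • w₀) :
    ∃ w ≠ 0, ∀ g ∈ G, ∃ c : K, ρ g w = c • w := by
  choose! χ hχ using h₀
  have hmul (g h : Γ) (w : V) : ρ g (ρ h w) = ρ (g * h) w := by
    rw [map_mul, Module.End.mul_apply]
  let W : Submodule K V := ⨅ g ∈ ⁅G, G⁆, LinearMap.ker (ρ g - χ g • LinearMap.id)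
  have mem_W {w : V} : w ∈ W ↔ ∀ g ∈ ⁅G, G⁆, ρ g w = χ g • w := by
    simp [W, Submodule.mem_iInf, sub_eq_zero]
  have hW : W ≠ ⊥ := fun h => hw₀ (by simpa [h] using mem_W.2 hχ)
  have hconj {g h : Γ} (hg : g ∈ G) (hh : h ∈ ⁅G, G⁆) : g⁻¹ * h * g ∈ ⁅G, G⁆ := by
    have h1 : ⁅g⁻¹, h⁆ ∈ ⁅G, G⁆ := Subgroup.commutator_mem_commutator (inv_mem hg)
      (Subgroup.commutator_le_self G hh)
    have h2 := mul_mem h1 hh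
    rwa [commutatorElement_def, inv_inv, inv_mul_cancel_right] at h2
  have hstab {g : Γ} (hg : g ∈ G) {w : V} (hw : w ∈ W) : ρ g w ∈ W := by
    rcases eq_or_ne w 0 with rfl | hw0
    · simp
    refine mem_W.2 fun h hh => ?_
    refine eq_smul_of_isPreconnected hρ hG.isPreconnected hw0 (ρ h) (fun g hg => ?_)
      (one_mem G) ?_ g hg
    · refine ⟨χ (g⁻¹ * h * g), ?_⟩
      rw [← map_smul, ← mem_W.1 hw _ (hconj hg hh), hmul, hmul]
      congr 2
      group
    · simpa using mem_W.1 hw h hh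
  have hcommute {g h : Γ} (hg : g ∈ G) (hh : h ∈ G) {w : V} (hw : w ∈ W) :
      ρ g (ρ h w) = ρ h (ρ g w) := by
    -- Along the orbit of `w₁` the eigenvalue of `h` is `c * χ ⁅g⁻¹, h⁆`, yet by connectedness it is
    -- always `c`. As `c ≠ 0`, the scalar `χ ⁅g⁻¹, h⁆` is `1`.
    obtain ⟨w₁, hw₁, hne, c, hc⟩ := exists_eigenvector_mem hW (ρ h) fun w hw => hstab hh hw
    have hk {g : Γ} (hg : g ∈ G) : ⁅g⁻¹, h⁆ ∈ ⁅G, G⁆ :=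
      Subgroup.commutator_mem_commutator (inv_mem hg) hh
    have hcw (g : Γ) (w : V) : ρ h (ρ g w) = ρ g (ρ ⁅g⁻¹, h⁆ (ρ h w)) := by
      rw [hmul, hmul, hmul]
      congr 2
      rw [commutatorElement_def]
      group
    have h1 {g : Γ} (hg : g ∈ G) : ρ h (ρ g w₁) = (c * χ ⁅g⁻¹, h⁆) • ρ g w₁ := by
      rw [hcw, hc, map_smul, mem_W.1 hw₁ _ (hk hg), map_smul, map_smul, mul_smul]
    have h2 := eq_smul_of_isPreconnected hρ hG.isPreconnected hne (ρ h)
      (fun g hg => ⟨_, h1 hg⟩) (one_mem G) (c₀ := c) (by simpa using hc) g hg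
    have hinj : ρ g w₁ ≠ 0 := fun h0 => hne (by
      have := hmul g⁻¹ g w₁
      simpa [h0] using this.symm)
    have h3 : c * χ ⁅g⁻¹, h⁆ = c := smul_left_injective K hinj ((h1 hg).symm.trans h2)
    have hc0 : c ≠ 0 := by
      rintro rfl
      refine hne ?_
      have := hmul h⁻¹ h w₁
      simpa [hc] using this.symm
    have h4 : χ ⁅g⁻¹, h⁆ = 1 := mul_left_cancel₀ hc0 (h3.trans (mul_one c).symm)
    rw [hcw, mem_W.1 (hstab hh hw) _ (hk hg), h4, one_smul]
  obtain ⟨w, -, hw, h⟩ := exists_common_eigenvector_of_commute (ρ '' G) hW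
    (by rintro _ ⟨g, hg, rfl⟩ w hw; exact hstab hg hw)
    (by rintro _ ⟨g, hg, rfl⟩ _ ⟨h, hh, rfl⟩ w hw; exact hcommute hg hh hw)
  exact ⟨w, hw, fun g hg => h _ ⟨g, hg, rfl⟩⟩

/-- The **Lie–Kolchin theorem**: a connected solvable group has a common eigenvector. -/
theorem exists_common_eigenvector_of_isSolvable [ConnectedSpace Γ] [Nontrivial V]
    (hΓ : Group.IsSolvable Γ)
    (hmul : ∀ h : Γ, Continuous fun g => h * g)
    (hcomm : ∀ h : Γ, Continuous fun g => g * h * g⁻¹ * h⁻¹) (ρ : Γ →* End K V)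
    (hρ : ∀ (f : Dual K V) (w : V), IsClosed {g | f (ρ g w) = 0}) :
    ∃ w ≠ 0, ∀ g, ∃ c : K, ρ g w = c • w := by
  obtain ⟨n, hn⟩ := hΓ.solvable
  suffices h : ∀ m ≤ n, ∃ w ≠ 0, ∀ g ∈ derivedSeries Γ m, ∃ c : K, ρ g w = c • w by
    obtain ⟨w, hw, h⟩ := h 0 n.zero_le
    exact ⟨w, hw, fun g => h g (by simp)⟩
  intro m hm
  induction hm using Nat.decreasingInduction with
  | self =>
    obtain ⟨w, hw⟩ := exists_ne (0 : V)
    refine ⟨w, hw, fun g hg => ⟨1, ?_⟩⟩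
    rw [hn, Subgroup.mem_bot] at hg
    simp [hg]
  | of_succ m hm ih =>
    obtain ⟨w, hw, h⟩ := ih
    exact exists_common_eigenvector_of_commutator hρ (isConnected_derivedSeries hmul hcomm m) hw h

end LieKolchin

/-! ### Zariski topology on `GL(V)` and families with regular coefficients -/

namespace LinearAlgebraicGroup

open Module

attribute [local instance] zariskiTopologyGL

section Regular

variable {K : Type u} [Field K] {V : Type u} [AddCommGroup V] [Module K V] {X : Type*}

theorem isClosed_zariskiTopology_iff {W : Type u} [AddCommGroup W] [Module K W] {Z : Set W} :
    @IsClosed W (zariskiTopology K W) Z ↔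
      ∃ S : Set (W → K), S ⊆ polynomialFunctions K W ∧ Z = {w | ∀ p ∈ S, p w = 0} := by
  let _ := zariskiTopology K W
  rw [← isOpen_compl_iff]
  change Zᶜᶜ ∈ {Z : Set W | _} ↔ _
  rw [compl_compl]
  rfl

/-- A family of endomorphisms all of whose matrix coefficients lie in a given algebra. -/
def IsRegular (𝒜 : Subalgebra K (X → K)) (m : X → End K V) : Prop :=
  ∀ (f : Dual K V) (w : V), (fun x => f (m x w)) ∈ 𝒜

variable {𝒜 : Subalgebra K (X → K)}

theorem const_mem (𝒜 : Subalgebra K (X → K)) (c : K) : (fun _ => c) ∈ 𝒜 := 𝒜.algebraMap_mem c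

theorem isRegular_const (m : End K V) : IsRegular 𝒜 fun _ : X => m :=
  fun f w => const_mem 𝒜 (f (m w))

theorem IsRegular.bilin_mem [FiniteDimensional K V] {m₁ m₂ : X → End K V} (h₁ : IsRegular 𝒜 m₁)
    (h₂ : IsRegular 𝒜 m₂) (B : V →ₗ[K] V →ₗ[K] K) (v w : V) :
    (fun x => B (m₁ x v) (m₂ x w)) ∈ 𝒜 := by
  let b := finBasis K V
  have e : (fun x => B (m₁ x v) (m₂ x w)) =
      ∑ i, (fun x => b.coord i (m₁ x v)) * fun x => B (b i) (m₂ x w) := by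
    funext x
    simp only [Finset.sum_apply, Pi.mul_apply]
    conv_lhs => rw [← b.sum_repr (m₁ x v)]
    simp only [map_sum, map_smul, LinearMap.sum_apply, LinearMap.smul_apply, smul_eq_mul,
      Basis.coord_apply]
  rw [e]
  exact sum_mem fun i _ => mul_mem (h₁ _ _) (h₂ _ _)

theorem IsRegular.mul [FiniteDimensional K V] {m₁ m₂ : X → End K V} (h₁ : IsRegular 𝒜 m₁)
    (h₂ : IsRegular 𝒜 m₂) : IsRegular 𝒜 fun x => m₁ x * m₂ x := by
  intro f w
  let b := finBasis K V
  have e : (fun x => f ((m₁ x * m₂ x) w)) =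
      ∑ i, (fun x => b.coord i (m₂ x w)) * fun x => f (m₁ x (b i)) := by
    funext x
    simp only [Finset.sum_apply, Pi.mul_apply, Module.End.mul_apply]
    conv_lhs => rw [← b.sum_repr (m₂ x w)]
    simp only [map_sum, map_smul, smul_eq_mul, Basis.coord_apply]
  rw [e]
  exact sum_mem fun i _ => mul_mem (h₂ _ _) (h₁ _ _)

theorem IsRegular.dual_mem [FiniteDimensional K V] {m : X → End K V} (h : IsRegular 𝒜 m)
    (F : Dual K (End K V)) : (fun x => F (m x)) ∈ 𝒜 := by
  let b := finBasis K V
  have e : (fun x => F (m x)) =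
      ∑ i, ∑ j, (fun x => b.coord i (m x (b j))) *
        fun _ => F (LinearMap.toMatrix b b |>.symm (Matrix.single i j 1)) := by
    funext x
    simp only [Finset.sum_apply, Pi.mul_apply]
    conv_lhs =>
      rw [← (LinearMap.toMatrix b b).symm_apply_apply (m x),
        Matrix.matrix_eq_sum_single (LinearMap.toMatrix b b (m x))]
    simp only [map_sum]
    refine Finset.sum_congr rfl fun i _ => Finset.sum_congr rfl fun j _ => ?_
    rw [← mul_one (LinearMap.toMatrix b b (m x) i j), ← smul_eq_mul, ← Matrix.smul_single,
      map_smul, map_smul, LinearMap.toMatrix_apply, smul_eq_mul, Basis.coord_apply]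
  rw [e]
  exact sum_mem fun i _ => sum_mem fun j _ => mul_mem (h _ _) (const_mem 𝒜 _)

theorem IsRegular.polynomial_mem [FiniteDimensional K V] {m : X → End K V} (h : IsRegular 𝒜 m)
    {p : End K V → K} (hp : p ∈ polynomialFunctions K (End K V)) : (fun x => p (m x)) ∈ 𝒜 := by
  induction hp using Algebra.adjoin_induction with
  | mem p hp =>
    obtain ⟨F, rfl⟩ := hp
    exact h.dual_mem F
  | algebraMap c => exact const_mem 𝒜 c
  | add p q _ _ hp hq => exact add_mem hp hq
  | mul p q _ _ hp hq => exact mul_mem hp hq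

theorem IsRegular.continuous [FiniteDimensional K V] [TopologicalSpace X]
    (h𝒜 : ∀ a ∈ 𝒜, IsClosed {x | a x = 0}) {m : X → V ≃ₗ[K] V}
    (h : IsRegular 𝒜 fun x => (m x : End K V)) : Continuous m := by
  let _ := zariskiTopology K (End K V)
  refine continuous_induced_rng.2 (continuous_iff_isClosed.2 fun Z hZ => ?_)
  obtain ⟨S, hS, rfl⟩ := isClosed_zariskiTopology_iff.1 hZ
  convert isClosed_biInter fun p (hp : p ∈ S) => h𝒜 _ (h.polynomial_mem (hS hp)) using 1
  ext x
  simp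

/-- The image of an infinite field under a polynomial map is connected. -/
theorem isConnected_range_of_isRegular [FiniteDimensional K V] [Infinite K] {m : K → V ≃ₗ[K] V}
    (h : IsRegular (Polynomial.aeval (R := K) (id : K → K)).range fun x => (m x : End K V)) :
    IsConnected (Set.range m) := by
  refine ⟨Set.range_nonempty m, isPreconnected_closed_iff.2 fun Z₁ Z₂ hZ₁ hZ₂ hsub h₁ h₂ => ?_⟩
  -- A polynomial with infinitely many roots is zero, so a closed set containing the curve at
  -- infinitely many parameters contains all of it. One of two closed sets covering the curve does.
  have key (Z : Set (V ≃ₗ[K] V)) (hZ : IsClosed Z) (hinf : (m ⁻¹' Z).Infinite) :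
      Set.range m ⊆ Z := by
    let _ := zariskiTopology K (End K V)
    obtain ⟨Z', hZ', rfl⟩ := isClosed_induced_iff.1 hZ
    obtain ⟨S, hS, rfl⟩ := isClosed_zariskiTopology_iff.1 hZ'
    rintro _ ⟨t, rfl⟩ p hp
    obtain ⟨q, hq⟩ := h.polynomial_mem (hS hp)
    have hq' (t : K) : p (m t) = q.eval t := by
      have := congrFun hq t
      rw [← this]
      change _ = q.eval (id t)
      rw [← Polynomial.coe_aeval_eq_eval]
      exact (Polynomial.aeval_algHom_apply (Pi.evalAlgHom K (fun _ : K => K) t) id q).symm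
    have hq0 : q = 0 := by
      refine Polynomial.eq_zero_of_infinite_isRoot q (hinf.mono fun s hs => ?_)
      exact (hq' s).symm.trans (hs p hp)
    simp [hq', hq0]
  have hun : (m ⁻¹' Z₁ ∪ m ⁻¹' Z₂) = Set.univ :=
    Set.eq_univ_of_forall fun t => hsub ⟨t, rfl⟩
  have hinf : (m ⁻¹' Z₁).Infinite ∨ (m ⁻¹' Z₂).Infinite := by
    rw [← Set.infinite_union, hun]
    exact Set.infinite_univ
  rcases hinf with hi | hi
  · obtain ⟨x, hx, hx₂⟩ := h₂
    exact ⟨x, hx, key Z₁ hZ₁ hi hx, hx₂⟩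
  · obtain ⟨x, hx, hx₁⟩ := h₁
    exact ⟨x, hx, hx₁, key Z₂ hZ₂ hi hx⟩

/-- The functions on a subset of `GL(V)` that are polynomial in the matrix entries. -/
def coordinateRing (H : Set (V ≃ₗ[K] V)) : Subalgebra K (H → K) :=
  (polynomialFunctions K (End K V)).map
    (AlgHom.pi fun h : H => Pi.evalAlgHom K (fun _ : End K V => K) (h : V ≃ₗ[K] V))

theorem isClosed_of_mem_coordinateRing {H : Set (V ≃ₗ[K] V)} {a : H → K}
    (ha : a ∈ coordinateRing H) : IsClosed {h | a h = 0} := by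
  obtain ⟨p, hp, rfl⟩ := ha
  let _ := zariskiTopology K (End K V)
  have h1 : IsClosed {w : End K V | p w = 0} :=
    isClosed_zariskiTopology_iff.2 ⟨{p}, Set.singleton_subset_iff.2 hp, by simp⟩
  have h2 : Continuous fun g : V ≃ₗ[K] V => (g : End K V) := continuous_induced_dom
  exact (h1.preimage h2).preimage continuous_subtype_val

theorem isRegular_coe (H : Set (V ≃ₗ[K] V)) :
    IsRegular (coordinateRing H) fun h => ((h : V ≃ₗ[K] V) : End K V) := by
  intro f w
  exact ⟨_, Algebra.subset_adjoin ⟨f ∘ₗ LinearMap.applyₗ w, rfl⟩, rfl⟩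

/-- This shape covers linear conditions such as `g w ∈ A` (with `B = 0`) and the quadratic equations
that express multiplicativity. -/
theorem isClosed_zero_set [FiniteDimensional K V] (B : V →ₗ[K] V →ₗ[K] K) (f : Dual K V)
    (c : K) (u v w : V) :
    IsClosed {g : V ≃ₗ[K] V | B (g u) (g v) + f (g w) + c = 0} := by
  have h := isRegular_coe (Set.univ : Set (V ≃ₗ[K] V))
  have h1 := isClosed_of_mem_coordinateRing (add_mem (add_mem (h.bilin_mem h B u v) (h f w))
    (const_mem (coordinateRing (Set.univ : Set (V ≃ₗ[K] V))) c))
  have h2 := (isClosed_univ (X := V ≃ₗ[K] V)).isClosedEmbedding_subtypeVal.isClosedMap _ h1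
  convert h2 using 1
  ext g
  simp

theorem isClosed_setOf_apply_mem [FiniteDimensional K V] (A : Submodule K V) (w : V) :
    IsClosed {g : V ≃ₗ[K] V | g w ∈ A} := by
  have e : {g : V ≃ₗ[K] V | g w ∈ A} =
      ⋂ f : Dual K (V ⧸ A), {g | (0 : V →ₗ[K] V →ₗ[K] K) (g w) (g w) +
        (f ∘ₗ A.mkQ) (g w) + 0 = 0} := by
    ext g
    simp only [Set.mem_iInter, Set.mem_ofPred_eq, LinearMap.comp_apply, LinearMap.zero_apply,
      zero_add, add_zero]
    rw [Module.forall_dual_apply_eq_zero_iff]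
    simp
  rw [e]
  exact isClosed_iInter fun f => isClosed_zero_set _ _ _ _ _ _

theorem isClosed_setOf_map_le [FiniteDimensional K V] (A : Submodule K V) :
    IsClosed {g : V ≃ₗ[K] V | ∀ x ∈ A, g x ∈ A} := by
  simp only [Set.ofPred_forall]
  exact isClosed_biInter fun x _ => isClosed_setOf_apply_mem A x

theorem continuous_mul_left_GL [FiniteDimensional K V] (g : V ≃ₗ[K] V) :
    Continuous fun h : V ≃ₗ[K] V => g * h := by
  rw [← continuousOn_univ, continuousOn_iff_continuous_domRestrict]
  exact ((isRegular_const (g : End K V)).mul (isRegular_coe Set.univ)).continuous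
    fun _ => isClosed_of_mem_coordinateRing

theorem continuous_mul_right_GL [FiniteDimensional K V] (g : V ≃ₗ[K] V) :
    Continuous fun h : V ≃ₗ[K] V => h * g := by
  rw [← continuousOn_univ, continuousOn_iff_continuous_domRestrict]
  exact ((isRegular_coe Set.univ).mul (isRegular_const (g : End K V))).continuous
    fun _ => isClosed_of_mem_coordinateRing

/-- The Lie–Kolchin theorem for a linear group acting on a quotient space. -/
theorem exists_eigenvector_mod [IsAlgClosed K] [FiniteDimensional K V] {H : Subgroup (V ≃ₗ[K] V)}
    (hconn : IsConnected (H : Set (V ≃ₗ[K] V))) (hsol : Group.IsSolvable H)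
    (hinv : IsRegular (coordinateRing (H : Set (V ≃ₗ[K] V)))
      fun h => (((h : V ≃ₗ[K] V)⁻¹ : V ≃ₗ[K] V) : End K V))
    {A : Submodule K V} (hA : A ≠ ⊤) (hHA : ∀ h ∈ H, ∀ x ∈ A, h x ∈ A) :
    ∃ v ∉ A, ∀ h ∈ H, ∃ c : K, h v - c • v ∈ A := by
  have : ConnectedSpace H := Subtype.connectedSpace hconn
  have : Nontrivial (V ⧸ A) := Submodule.Quotient.nontrivial_iff.2 hA
  let ρ : H →* End K (V ⧸ A) :=
    { toFun := fun h => A.mapQ A (h.1 : End K V) (hHA h.1 h.2)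
      map_one' := by
        apply LinearMap.ext
        rintro ⟨x⟩
        rfl
      map_mul' := fun g h => by
        apply LinearMap.ext
        rintro ⟨x⟩
        rfl }
  -- The entries of `g⁻¹` need not be polynomials in those of `g`; `hinv` supplies this on `H`.
  have hcomm (h : H) : Continuous fun g : H => g * h * g⁻¹ * h⁻¹ := by
    refine continuous_induced_rng.2 ?_
    have hcoe := isRegular_coe (H : Set (V ≃ₗ[K] V))
    exact IsRegular.continuous (𝒜 := coordinateRing (H : Set (V ≃ₗ[K] V)))
      (fun _ => isClosed_of_mem_coordinateRing)
      (((hcoe.mul (isRegular_const (h.1 : End K V))).mul hinv).mul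
        (isRegular_const ((h.1⁻¹ : V ≃ₗ[K] V) : End K V)))
  obtain ⟨w, hw, h⟩ := exists_common_eigenvector_of_isSolvable hsol
    (fun h => continuous_induced_rng.2
      ((continuous_mul_left_GL h.1).comp continuous_subtype_val)) hcomm ρ (by
      rintro f ⟨w⟩
      exact isClosed_of_mem_coordinateRing
        (isRegular_coe (H : Set (V ≃ₗ[K] V)) (f ∘ₗ A.mkQ) w))
  obtain ⟨v, rfl⟩ := A.mkQ_surjective w
  refine ⟨v, by simpa using hw, fun g hg => ?_⟩
  obtain ⟨c, hc⟩ := h ⟨g, hg⟩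
  refine ⟨c, ?_⟩
  rw [← Submodule.Quotient.mk_eq_zero, Submodule.Quotient.mk_sub, sub_eq_zero]
  exact hc

end Regular

end LinearAlgebraicGroup

/-! ### Flag stabilizers and identity components -/

namespace LinearAlgebraicGroup

open Module
open scoped commutatorElement

attribute [local instance] zariskiTopologyGL

section Flag

variable {K : Type u} [Field K] {V : Type u} [AddCommGroup V] [Module K V]

/-- The stabilizer of a flag in `GL(V)`. -/
def flagStabilizer (G : ℕ → Submodule K V) : Subgroup (V ≃ₗ[K] V) where
  carrier := {g | ∀ i, ∀ x, g x ∈ G i ↔ x ∈ G i}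
  one_mem' _ _ := Iff.rfl
  mul_mem' {g h} hg hh i x := (hg i (h x)).trans (hh i x)
  inv_mem' {g} hg i x := by
    rw [← hg i]
    change g (g.symm x) ∈ _ ↔ _
    rw [g.apply_symm_apply]

theorem mem_flagStabilizer [FiniteDimensional K V] {G : ℕ → Submodule K V} {g : V ≃ₗ[K] V} :
    g ∈ flagStabilizer G ↔ ∀ i, ∀ x ∈ G i, g x ∈ G i := by
  refine ⟨fun h i x hx => (h i x).2 hx, fun h i x => ⟨fun hx => ?_, h i x⟩⟩
  have h1 : (G i).map (g : V →ₗ[K] V) = G i :=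
    Submodule.eq_of_le_of_finrank_eq (Submodule.map_le_iff_le_comap.2 (h i))
      (LinearEquiv.finrank_map_eq g (G i))
  rw [← h1] at hx
  obtain ⟨y, hy, e⟩ := hx
  rwa [← g.injective e]

theorem isClosed_flagStabilizer [FiniteDimensional K V] (G : ℕ → Submodule K V) :
    IsClosed (flagStabilizer G : Set (V ≃ₗ[K] V)) := by
  have e : (flagStabilizer G : Set (V ≃ₗ[K] V)) = ⋂ i, {g | ∀ x ∈ G i, g x ∈ G i} := by
    ext g
    simpa using mem_flagStabilizer
  rw [e]
  exact isClosed_iInter fun i => isClosed_setOf_map_le (G i)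

/-- The elements of the flag stabilizer that move each step of the flag `k` steps down. -/
def flagUnipotent (G : ℕ → Submodule K V) (k : ℕ) : Subgroup (flagStabilizer G) where
  carrier := {g | ∀ i, ∀ x ∈ G (i + k), g.1 x - x ∈ G i}
  one_mem' i x _ := by simp
  mul_mem' {g h} hg hh i x hx := by
    have h1 := (g.2 i _).2 (hh i x hx)
    have h2 := add_mem h1 (hg i x hx)
    rwa [map_sub, sub_add_sub_cancel] at h2
  inv_mem' {g} hg i x hx := by
    have h1 := (g.2 (i + k) (g.1.symm x)).1 (by rwa [g.1.apply_symm_apply])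
    have h2 := hg i _ h1
    rw [g.1.apply_symm_apply, ← neg_mem_iff, neg_sub] at h2
    exact h2

/-- At `x = hgy` the difference `⁅g, h⁆x - x` is `ghy - hgy`. For `k = 0` it drops one step, because
`g` and `h` act by scalars on each quotient of dimension at most one. For `k ≥ 1` it equals
`(g-1)(h-1)y - (h-1)(g-1)y`, which drops `2k ≥ k + 1` steps. -/
theorem commutator_mem_flagUnipotent {G : ℕ → Submodule K V} (hmono : Monotone G)
    (hrank : ∀ i, ∀ x ∈ G (i + 1), ∀ y ∈ G (i + 1), x ∉ G i → ∃ c : K, y - c • x ∈ G i)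
    {k : ℕ} {g h : flagStabilizer G} (hg : g ∈ flagUnipotent G k) (hh : h ∈ flagUnipotent G k) :
    ⁅g, h⁆ ∈ flagUnipotent G (k + 1) := by
  intro i x hx
  obtain ⟨y, rfl⟩ : ∃ y, h.1 (g.1 y) = x :=
    ⟨g.1.symm (h.1.symm x), by simp⟩
  have e : (⁅g, h⁆).1 (h.1 (g.1 y)) = g.1 (h.1 y) := by
    change g.1 (h.1 (g.1.symm (h.1.symm (h.1 (g.1 y))))) = _
    simp
  rw [e]
  have hy : y ∈ G (i + (k + 1)) := (g.2 _ _).1 ((h.2 _ _).1 hx)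
  rcases Nat.eq_zero_or_pos k with rfl | hk
  · by_cases hyi : y ∈ G i
    · exact sub_mem ((g.2 _ _).2 ((h.2 _ _).2 hyi)) ((h.2 _ _).2 ((g.2 _ _).2 hyi))
    · obtain ⟨c, hc⟩ := hrank i y hy (g.1 y) ((g.2 _ _).2 hy) hyi
      obtain ⟨d, hd⟩ := hrank i y hy (h.1 y) ((h.2 _ _).2 hy) hyi
      have h1 := (g.2 i _).2 hd
      have h2 := (h.2 i _).2 hc
      rw [map_sub, map_smul] at h1 h2
      have h3 := sub_mem (add_mem h1 ((G i).smul_mem d hc)) (add_mem h2 ((G i).smul_mem c hd))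
      convert h3 using 1
      rw [smul_sub, smul_sub, smul_comm c d y]
      abel
  · have h1 : h.1 y - y ∈ G (i + 1) := hh (i + 1) y (by convert hy using 2; ring)
    have h2 : g.1 y - y ∈ G (i + 1) := hg (i + 1) y (by convert hy using 2; ring)
    have h3 := hg i _ (hmono (by omega : i + 1 ≤ i + k) h1)
    have h4 := hh i _ (hmono (by omega : i + 1 ≤ i + k) h2)
    have h5 := sub_mem h3 h4
    rw [map_sub, map_sub] at h5
    convert h5 using 1
    abel

/-- The stabilizer of a full flag is solvable. -/
theorem isSolvable_flagStabilizer {G : ℕ → Submodule K V} (hmono : Monotone G) (h0 : G 0 = ⊥)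
    {n : ℕ} (hn : G n = ⊤)
    (hrank : ∀ i, ∀ x ∈ G (i + 1), ∀ y ∈ G (i + 1), x ∉ G i → ∃ c : K, y - c • x ∈ G i) :
    Group.IsSolvable (flagStabilizer G) := by
  have key (k : ℕ) : derivedSeries (flagStabilizer G) k ≤ flagUnipotent G k := by
    induction k with
    | zero =>
      intro g _ i x hx
      exact sub_mem ((g.2 i x).2 hx) hx
    | succ k ih =>
      rw [derivedSeries_succ, Subgroup.commutator_le]
      exact fun g hg h hh => commutator_mem_flagUnipotent hmono hrank (ih hg) (ih hh)
  refine ⟨⟨n, (Subgroup.eq_bot_iff_forall _).2 fun g hg => ?_⟩⟩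
  refine Subtype.ext (LinearEquiv.ext fun x => ?_)
  have h1 := key n hg 0 x (by rw [zero_add, hn]; trivial)
  rw [h0, Submodule.mem_bot, sub_eq_zero] at h1
  exact h1

/-- The connected component of `1` in a subgroup of `GL(V)`. -/
def identityComponent [FiniteDimensional K V] (S : Subgroup (V ≃ₗ[K] V)) :
    Subgroup (V ≃ₗ[K] V) where
  carrier := connectedComponentIn (S : Set (V ≃ₗ[K] V)) 1
  one_mem' := mem_connectedComponentIn (one_mem S)
  mul_mem' {g h} hg hh := by
    have hgS : g ∈ S := connectedComponentIn_subset _ _ hg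
    rw [connectedComponentIn_eq hg]
    refine (isPreconnected_connectedComponentIn.image (fun x => g * x)
      (continuous_mul_left_GL g).continuousOn).subset_connectedComponentIn
      ⟨1, mem_connectedComponentIn (one_mem S), mul_one g⟩ ?_ ⟨h, hh, rfl⟩
    rintro _ ⟨x, hx, rfl⟩
    exact mul_mem hgS (connectedComponentIn_subset _ _ hx)
  inv_mem' {g} hg := by
    have hgS : g ∈ S := connectedComponentIn_subset _ _ hg
    refine (isPreconnected_connectedComponentIn.image (fun x => g⁻¹ * x)
      (continuous_mul_left_GL g⁻¹).continuousOn).subset_connectedComponentIn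
      ⟨g, hg, inv_mul_cancel g⟩ ?_ ⟨1, mem_connectedComponentIn (one_mem S), mul_one _⟩
    rintro _ ⟨x, hx, rfl⟩
    exact mul_mem (inv_mem hgS) (connectedComponentIn_subset _ _ hx)

theorem identityComponent_le [FiniteDimensional K V] (S : Subgroup (V ≃ₗ[K] V)) :
    identityComponent S ≤ S := connectedComponentIn_subset _ _

theorem isClosed_identityComponent [FiniteDimensional K V] {S : Subgroup (V ≃ₗ[K] V)}
    (hS : IsClosed (S : Set (V ≃ₗ[K] V))) :
    IsClosed (identityComponent S : Set (V ≃ₗ[K] V)) := by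
  change IsClosed (connectedComponentIn (S : Set (V ≃ₗ[K] V)) 1)
  rw [connectedComponentIn_eq_image (one_mem S)]
  exact hS.isClosedEmbedding_subtypeVal.isClosedMap _ isClosed_connectedComponent

/-- The connected set `C` lies in the component. A connected solvable group above the component
contains `C`, hence lies in `S`, hence in the component. Connectedness of `S` itself is never
needed. -/
theorem isBorel_identityComponent [FiniteDimensional K V] {G S : Subgroup (V ≃ₗ[K] V)}
    (hSG : S ≤ G) (hS : IsClosed (S : Set (V ≃ₗ[K] V))) (hsol : Group.IsSolvable S)
    {C : Set (V ≃ₗ[K] V)} (hC : IsPreconnected C) (h1 : 1 ∈ C) (hCS : C ⊆ S)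
    (hmax : ∀ H : Subgroup (V ≃ₗ[K] V), H ≤ G → IsConnected (H : Set (V ≃ₗ[K] V)) →
      Group.IsSolvable H → C ⊆ H → H ≤ S) :
    IsBorel G (identityComponent S) := by
  refine ⟨⟨(identityComponent_le S).trans hSG, isClosed_identityComponent hS,
    isConnected_connectedComponentIn_iff.2 (one_mem S), ?_⟩, ?_⟩
  · exact Group.isSolvable_of_isSolvable_injective
      (Subgroup.inclusion_injective (identityComponent_le S))
  · rintro H ⟨hHG, -, hH, hHsol⟩ hle
    exact hH.isPreconnected.subset_connectedComponentIn (one_mem H) (hmax H hHG hH hHsol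
      ((hC.subset_connectedComponentIn h1 hCS).trans hle))

end Flag

end LinearAlgebraicGroup

/-! ### `G₂` and its line stabilizers as Zariski closed groups -/

namespace Zorn

open Module LinearAlgebraicGroup

attribute [local instance] zariskiTopologyGL

section Group

variable {K : Type u} [Field K]

/-- The octonions in coordinates. -/
def equivProd : Zorn K ≃ₗ[K] K × (Fin 3 → K) × (Fin 3 → K) × K where
  toFun x := (x.a, x.v, x.φ, x.d)
  invFun y := ⟨y.1, y.2.1, y.2.2.1, y.2.2.2⟩
  map_add' _ _ := rfl
  map_smul' _ _ := rfl
  left_inv _ := rfl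
  right_inv _ := rfl

instance : FiniteDimensional K (Zorn K) := LinearEquiv.finiteDimensional equivProd.symm

/-- The polar form of the norm. -/
def polar : LinearMap.BilinForm K (Zorn K) :=
  LinearMap.mk₂ K (fun x y => x.a * y.d + x.d * y.a - x.φ ⬝ᵥ y.v - y.φ ⬝ᵥ x.v)
    (by intros; simp; ring) (by intros; simp; ring) (by intros; simp; ring)
    (by intros; simp; ring)

theorem polar_apply (x y : Zorn K) :
    polar x y = x.a * y.d + x.d * y.a - x.φ ⬝ᵥ y.v - y.φ ⬝ᵥ x.v := rfl

theorem polar_eq (x y : Zorn K) : polar x y = norm (x + y) - norm x - norm y := by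
  simp [polar_apply, norm]; ring

theorem polar_map {g : Zorn K ≃ₗ[K] Zorn K} (hg : g ∈ G2 K) (x y : Zorn K) :
    polar (g x) (g y) = polar x y := by
  simp only [polar_eq, ← map_add, norm_apply_of_mem_G2 hg]

theorem exists_polar_eq (f : Dual K (Zorn K)) : ∃ z, ∀ x, f x = polar x z := by
  have hinj : Function.Injective (polar (K := K)).flip := by
    rw [injective_iff_map_eq_zero]
    intro z hz
    have h (x : Zorn K) : polar x z = 0 := LinearMap.congr_fun hz x
    apply Zorn.ext
    · simpa [polar_apply] using h ⟨0, 0, 0, 1⟩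
    · funext i
      simpa [polar_apply] using h ⟨0, 0, Pi.single i 1, 0⟩
    · funext i
      simpa [polar_apply] using h ⟨0, Pi.single i 1, 0, 0⟩
    · simpa [polar_apply] using h ⟨1, 0, 0, 0⟩
  have hsurj : Function.Surjective (polar (K := K)).flip :=
    (LinearMap.injective_iff_surjective_of_finrank_eq_finrank
      (Subspace.dual_finrank_eq (K := K) (V := Zorn K)).symm).1 hinj
  obtain ⟨z, rfl⟩ := hsurj f
  exact ⟨z, fun x => rfl⟩

/-- On a subgroup of `G₂` the inverse is the adjoint with respect to the norm form. -/
theorem isRegular_inv {H : Subgroup (Zorn K ≃ₗ[K] Zorn K)} (hH : H ≤ G2 K) :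
    IsRegular (coordinateRing (H : Set (Zorn K ≃ₗ[K] Zorn K)))
      fun h => (((h : Zorn K ≃ₗ[K] Zorn K)⁻¹ : Zorn K ≃ₗ[K] Zorn K) : End K (Zorn K)) := by
  intro f w
  obtain ⟨z, hz⟩ := exists_polar_eq f
  convert isRegular_coe (H : Set (Zorn K ≃ₗ[K] Zorn K)) (polar w) z using 2 with h
  change f (h.1.symm w) = polar w (h.1 z)
  rw [hz, ← polar_map (hH h.2), h.1.apply_symm_apply]

/-- The multiplication of octonions as a bilinear map. -/
def mulBilin : Zorn K →ₗ[K] Zorn K →ₗ[K] Zorn K :=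
  LinearMap.mk₂ K (fun x y => x * y)
    (by intros; apply ext_coord <;> simp [cross_zero, cross_one, cross_two] <;> ring)
    (by intros; apply ext_coord <;> simp [cross_zero, cross_one, cross_two] <;> ring)
    (by intros; apply ext_coord <;> simp [cross_zero, cross_one, cross_two] <;> ring)
    (by intros; apply ext_coord <;> simp [cross_zero, cross_one, cross_two] <;> ring)

/-- The conjugation as a linear map. -/
def conjₗ : Zorn K →ₗ[K] Zorn K where
  toFun := conj
  map_add' x y := by ext <;> simp [add_comm]
  map_smul' c x := by ext <;> simp

theorem isClosed_G2 : IsClosed (G2 K : Set (Zorn K ≃ₗ[K] Zorn K)) := by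
  have e : (G2 K : Set (Zorn K ≃ₗ[K] Zorn K)) = ⋂ f : Dual K (Zorn K), ({g |
      (0 : Zorn K →ₗ[K] Zorn K →ₗ[K] K) (g 0) (g 0) + f (g 1) + -f 1 = 0} ∩
      ((⋂ x, {g | (0 : Zorn K →ₗ[K] Zorn K →ₗ[K] K) (g 0) (g 0) +
        (f (g (conj x)) - f (conj (g x))) + 0 = 0}) ∩
      ⋂ x, ⋂ y, {g | (mulBilin.compr₂ f) (g x) (g y) + (-f) (g (x * y)) + 0 = 0})) := by
    ext g
    simp only [Set.mem_iInter, Set.mem_inter_iff, Set.mem_ofPred_eq, LinearMap.zero_apply, zero_add,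
      add_zero, ← sub_eq_add_neg, LinearMap.neg_apply, LinearMap.compr₂_apply, ← map_sub,
      forall_and]
    rw [Module.forall_dual_apply_eq_zero_iff, forall_comm]
    conv_rhs => enter [2, 2]; rw [forall_comm]; enter [x]; rw [forall_comm]
    simp only [Module.forall_dual_apply_eq_zero_iff, sub_eq_zero]
    exact ⟨fun h => ⟨h.1, h.2.1, fun x y => (h.2.2 x y).symm⟩,
      fun h => ⟨h.1, h.2.1, fun x y => (h.2.2 x y).symm⟩⟩
  rw [e]
  refine isClosed_iInter fun f => (isClosed_zero_set _ _ _ _ _ _).inter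
    ((isClosed_iInter fun x => ?_).inter
      (isClosed_iInter fun x => isClosed_iInter fun y => isClosed_zero_set _ _ _ _ _ _))
  have h := isRegular_coe (Set.univ : Set (Zorn K ≃ₗ[K] Zorn K))
  have h1 := isClosed_of_mem_coordinateRing (sub_mem (h f (conj x)) (h (f ∘ₗ conjₗ) x))
  have h2 := (isClosed_univ (X := Zorn K ≃ₗ[K] Zorn K)).isClosedEmbedding_subtypeVal.isClosedMap _ h1
  convert h2 using 1
  ext g
  simp [conjₗ]

/-- The stabilizer in `G₂` of the line through an octonion. -/
def lineStabilizer (x : Zorn K) : Subgroup (Zorn K ≃ₗ[K] Zorn K) :=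
  G2 K ⊓ MulAction.stabilizer (Zorn K ≃ₗ[K] Zorn K) (Submodule.span K {x})

theorem mem_lineStabilizer {x : Zorn K} {g : Zorn K ≃ₗ[K] Zorn K} :
    g ∈ lineStabilizer x ↔ g ∈ G2 K ∧ g x ∈ Submodule.span K {x} := by
  refine and_congr_right fun _ => ?_
  change g ∈ MulAction.stabilizer _ _ ↔ _
  rw [MulAction.mem_stabilizer_iff, smul_span_singleton]
  constructor
  · intro h
    rw [← h]
    exact Submodule.mem_span_singleton_self _
  · intro h
    rcases eq_or_ne x 0 with rfl | hx
    · simp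
    obtain ⟨c, hc⟩ := Submodule.mem_span_singleton.1 h
    have hc0 : c ≠ 0 := by
      rintro rfl
      rw [zero_smul] at hc
      exact hx (by simpa using hc.symm)
    rw [← hc, Submodule.span_singleton_smul_eq (isUnit_iff_ne_zero.2 hc0)]

theorem isClosed_lineStabilizer (x : Zorn K) :
    IsClosed (lineStabilizer x : Set (Zorn K ≃ₗ[K] Zorn K)) := by
  have e : (lineStabilizer x : Set (Zorn K ≃ₗ[K] Zorn K)) =
      (G2 K : Set (Zorn K ≃ₗ[K] Zorn K)) ∩ {g | g x ∈ Submodule.span K {x}} := by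
    ext g
    exact mem_lineStabilizer
  rw [e]
  exact isClosed_G2.inter (isClosed_setOf_apply_mem _ _)

end Group

/-! ### A Borel subgroup of `G₂` fixing the line of `e₁` -/

section Borel

variable {K : Type u} [Field K]

/-- Coordinates on the octonions in the order of the weights of a maximal torus. -/
def weightCoord : ℕ → Dual K (Zorn K)
  -- With the trace first, `flag 1` is the line of the unit, fixed by all of `G₂`. The other seven
  -- coordinates belong to the weights of `V₇`, with the zero weight `a - d` in the middle. Indices
  -- from `8` on carry no condition, so `flag 8` is everything.
  | 0 => trace
  | 1 => { toFun := fun x => x.v 0, map_add' := fun _ _ => rfl, map_smul' := fun _ _ => rfl }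
  | 2 => { toFun := fun x => x.φ 2, map_add' := fun _ _ => rfl, map_smul' := fun _ _ => rfl }
  | 3 => { toFun := fun x => x.φ 1, map_add' := fun _ _ => rfl, map_smul' := fun _ _ => rfl }
  | 4 => { toFun := fun x => x.a - x.d
           map_add' := fun x y => by simp; ring
           map_smul' := fun c x => by simp; ring }
  | 5 => { toFun := fun x => x.v 1, map_add' := fun _ _ => rfl, map_smul' := fun _ _ => rfl }
  | 6 => { toFun := fun x => x.v 2, map_add' := fun _ _ => rfl, map_smul' := fun _ _ => rfl }
  | 7 => { toFun := fun x => x.φ 0, map_add' := fun _ _ => rfl, map_smul' := fun _ _ => rfl }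
  | _ + 8 => 0

/-- The full flag defined by the weight coordinates. -/
def flag (i : ℕ) : Submodule K (Zorn K) := ⨅ j ≥ i, LinearMap.ker (weightCoord j)

theorem mem_flag {i : ℕ} {x : Zorn K} : x ∈ flag i ↔ ∀ j ≥ i, weightCoord j x = 0 := by
  simp [flag, Submodule.mem_iInf]

theorem monotone_flag : Monotone (flag (K := K)) := by
  intro i j h x hx
  exact mem_flag.2 fun k hk => mem_flag.1 hx k (h.trans hk)

theorem mem_flag_of_succ {i : ℕ} {x : Zorn K} (hx : x ∈ flag (i + 1))
    (h : weightCoord i x = 0) : x ∈ flag i := by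
  refine mem_flag.2 fun j hj => ?_
  rcases Nat.eq_or_lt_of_le hj with rfl | hj
  · exact h
  · exact mem_flag.1 hx j hj

theorem flag_eight : flag 8 = (⊤ : Submodule K (Zorn K)) := by
  refine eq_top_iff.2 fun x _ => mem_flag.2 fun j hj => ?_
  obtain ⟨k, rfl⟩ := Nat.exists_eq_add_of_le' hj
  rfl

theorem flag_rank (i : ℕ) (x : Zorn K) (hx : x ∈ flag (i + 1)) (y : Zorn K)
    (hy : y ∈ flag (i + 1)) (h : x ∉ flag i) : ∃ c : K, y - c • x ∈ flag i := by
  have hc : weightCoord i x ≠ 0 := fun h0 => h (mem_flag_of_succ hx h0)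
  refine ⟨weightCoord i y / weightCoord i x,
    mem_flag_of_succ (sub_mem hy (Submodule.smul_mem _ _ hx)) ?_⟩
  rw [map_sub, map_smul, smul_eq_mul, div_mul_cancel₀ _ hc, sub_self]

theorem mem_flag_one [CharZero K] {x : Zorn K} (hx : x ∈ flag 1) : x = x.a • 1 := by
  have h (j : ℕ) (hj : 1 ≤ j) := mem_flag.1 hx j hj
  have h4 : x.a - x.d = 0 := h 4 (by norm_num)
  apply ext_coord
  · simp
  · exact (h 1 le_rfl).trans (by simp)
  · exact (h 5 (by norm_num)).trans (by simp)
  · exact (h 6 (by norm_num)).trans (by simp)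
  · exact (h 7 (by norm_num)).trans (by simp)
  · exact (h 3 (by norm_num)).trans (by simp)
  · exact (h 2 (by norm_num)).trans (by simp)
  · simpa using (sub_eq_zero.1 h4).symm

theorem flag_zero [CharZero K] : flag 0 = (⊥ : Submodule K (Zorn K)) := by
  refine eq_bot_iff.2 fun x hx => ?_
  have h1 := mem_flag_one (monotone_flag zero_le_one hx)
  have h2 : x.a + x.d = 0 := mem_flag.1 hx 0 le_rfl
  have h3 : x.d = x.a := by rw [h1]; simp
  have h4 : (2 : K) * x.a = 0 := by linear_combination h2 - h3
  rw [Submodule.mem_bot, h1, (mul_eq_zero.1 h4).resolve_left two_ne_zero, zero_smul]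

/-- In `flag 2` only multiples of `1` and `e₁` remain, and `1` has trace `2 ≠ 0`. So a
flag-preserving automorphism fixes the line of `e₁`. -/
theorem mem_span_e₁ [CharZero K] {x : Zorn K} (hx : x ∈ flag 2) (ht : x ∈ V7 K) :
    x ∈ Submodule.span K {(e₁ : Zorn K)} := by
  have h (j : ℕ) (hj : 2 ≤ j) := mem_flag.1 hx j hj
  have h4 : x.a - x.d = 0 := h 4 (by norm_num)
  rw [mem_V7] at ht
  have ha : x.a = 0 := by
    have : (2 : K) * x.a = 0 := by linear_combination ht + h4
    exact (mul_eq_zero.1 this).resolve_left two_ne_zero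
  refine Submodule.mem_span_singleton.2 ⟨x.v 0, ?_⟩
  symm
  apply ext_coord
  · simpa [e₁, ofV] using ha
  · simp [e₁, ofV]
  · exact (h 5 (by norm_num)).trans (by simp [e₁, ofV])
  · exact (h 6 (by norm_num)).trans (by simp [e₁, ofV])
  · exact (h 7 (by norm_num)).trans (by simp [e₁, ofV])
  · exact (h 3 (by norm_num)).trans (by simp [e₁, ofV])
  · exact (h 2 (by norm_num)).trans (by simp [e₁, ofV])
  · simpa [e₁, ofV, ha] using h4

theorem e₁_mem_flag : (e₁ : Zorn K) ∈ flag 2 := by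
  refine mem_flag.2 fun j hj => ?_
  match j with
  | 2 | 3 | 5 | 6 | 7 => simp [weightCoord, e₁, ofV]
  | 4 => simp [weightCoord, e₁, ofV]
  | j + 8 => rfl

/-- A transvection in `SL₃`. -/
def transvection (t : K) : Matrix.SpecialLinearGroup (Fin 3) K :=
  ⟨!![1, 0, 0; 0, 1, t; 0, 0, 1], by simp [Matrix.det_fin_three]⟩

/-- A curve in `G₂` through `1` whose nontrivial points are regular unipotent elements. -/
def unipotentCurve (t : K) : Zorn K ≃ₗ[K] Zorn K :=
  expΦ (Pi.single 1 t) * sl3Action K (transvection t)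

theorem unipotentCurve_mem_G2 (t : K) : unipotentCurve t ∈ G2 K :=
  mul_mem (expΦ_mem_G2 _) (sl3Action_mem_G2 _)

theorem transvection_apply (t : K) (x : Zorn K) :
    sl3Action K (transvection t) x =
      ⟨x.a, x.v + t • Pi.single 1 (x.v 2), x.φ - t • Pi.single 2 (x.φ 1), x.d⟩ := by
  have h1 : (transvection t).1 = !![1, 0, 0; 0, 1, t; 0, 0, 1] := rfl
  have h2 : ((transvection t)⁻¹).1 = !![1, 0, 0; 0, 1, -t; 0, 0, 1] := by
    rw [Matrix.SpecialLinearGroup.coe_inv, h1, Matrix.adjugate_fin_three]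
    ext i j
    fin_cases i <;> fin_cases j <;> simp
  rw [sl3Action_apply, h1, h2]
  apply ext_coord <;> simp [Matrix.mulVec, dotProduct, Fin.sum_univ_three, sub_eq_add_neg] <;> ring

theorem unipotentCurve_apply (t : K) (x : Zorn K) :
    unipotentCurve t x = ⟨x.a - t * (x.v 1 + t * x.v 2),
      ![x.v 0 + t * (x.φ 2 - t * x.φ 1), x.v 1 + t * x.v 2, x.v 2 - t * x.φ 0],
      ![x.φ 0, x.φ 1 + t * (x.a - x.d) - t ^ 2 * (x.v 1 + t * x.v 2), x.φ 2 - t * x.φ 1],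
      x.d + t * (x.v 1 + t * x.v 2)⟩ := by
  change expΦ _ (sl3Action K _ x) = _
  rw [transvection_apply, expΦ_apply]
  apply ext_coord <;>
    simp [cross_zero, cross_one, cross_two] <;> ring

theorem unipotentCurve_zero : unipotentCurve (0 : K) = 1 := by
  refine LinearEquiv.ext fun x => ?_
  rw [unipotentCurve_apply]
  apply ext_coord <;> simp

theorem isConnected_range_unipotentCurve [Infinite K] :
    IsConnected (Set.range (unipotentCurve (K := K))) := by
  refine isConnected_range_of_isRegular fun f w => ?_
  -- The coefficients come from sorting `unipotentCurve_apply` by powers of `t`, up to degree three.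
  refine ⟨Polynomial.C (f w) +
    Polynomial.X * Polynomial.C (f ⟨-w.v 1, ![w.φ 2, w.v 2, -w.φ 0],
      ![0, w.a - w.d, -w.φ 1], w.v 1⟩) +
    Polynomial.X ^ 2 * Polynomial.C (f ⟨-w.v 2, ![-w.φ 1, 0, 0], ![0, -w.v 1, 0], w.v 2⟩) +
    Polynomial.X ^ 3 * Polynomial.C (f ⟨0, 0, ![0, -w.v 2, 0], 0⟩), ?_⟩
  funext t
  have e : unipotentCurve t w = w + t • ⟨-w.v 1, ![w.φ 2, w.v 2, -w.φ 0],
      ![0, w.a - w.d, -w.φ 1], w.v 1⟩ +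
      t ^ 2 • ⟨-w.v 2, ![-w.φ 1, 0, 0], ![0, -w.v 1, 0], w.v 2⟩ +
      t ^ 3 • ⟨0, 0, ![0, -w.v 2, 0], 0⟩ := by
    rw [unipotentCurve_apply]
    apply ext_coord <;> simp [-Matrix.add_cons] <;> ring
  change _ = f (unipotentCurve t w)
  rw [e]
  simp only [map_add, map_smul, map_mul, map_pow, smul_eq_mul]
  simp [Polynomial.aeval_C]

/-- In the weight coordinates the curve is upper triangular with ones on the diagonal. -/
theorem weightCoord_unipotentCurve_of_mem (t : K) {x : Zorn K} {m : ℕ} (hx : x ∈ flag (m + 1)) :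
    weightCoord m (unipotentCurve t x) = weightCoord m x := by
  have h (j : ℕ) (hj : m + 1 ≤ j) := mem_flag.1 hx j hj
  rw [unipotentCurve_apply]
  match m with
  | 0 => simp [weightCoord]
  | 1 =>
    have h2 : x.φ 2 = 0 := h 2 (by norm_num)
    have h3 : x.φ 1 = 0 := h 3 (by norm_num)
    simp [weightCoord, h2, h3]
  | 2 =>
    have h3 : x.φ 1 = 0 := h 3 (by norm_num)
    simp [weightCoord, h3]
  | 3 =>
    have h4 : x.a - x.d = 0 := h 4 (by norm_num)
    have h5 : x.v 1 = 0 := h 5 (by norm_num)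
    have h6 : x.v 2 = 0 := h 6 (by norm_num)
    simp [weightCoord, h4, h5, h6]
  | 4 =>
    have h5 : x.v 1 = 0 := h 5 (by norm_num)
    have h6 : x.v 2 = 0 := h 6 (by norm_num)
    simp [weightCoord, h5, h6]
  | 5 =>
    have h6 : x.v 2 = 0 := h 6 (by norm_num)
    simp [weightCoord, h6]
  | 6 =>
    have h7 : x.φ 0 = 0 := h 7 (by norm_num)
    simp [weightCoord, h7]
  | 7 => simp [weightCoord]
  | _ + 8 => rfl

theorem unipotentCurve_mem_flag (t : K) (i : ℕ) (x : Zorn K) (hx : x ∈ flag i) :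
    unipotentCurve t x ∈ flag i := by
  refine mem_flag.2 fun j hj => ?_
  rw [weightCoord_unipotentCurve_of_mem t (monotone_flag (by omega) hx)]
  exact mem_flag.1 hx j hj

/-- The unipotent element `unipotentCurve 1` is regular. -/
theorem exists_weightCoord_unipotentCurve [CharZero K] {m : ℕ} (hm : 1 ≤ m) (hm' : m ≤ 6) :
    ∃ γ : K, γ ≠ 0 ∧ ∀ x ∈ flag (m + 2), weightCoord m (unipotentCurve 1 x) =
      weightCoord m x + γ * weightCoord (m + 1) x := by
  have h {x : Zorn K} (hx : x ∈ flag (m + 2)) (j : ℕ) (hj : m + 2 ≤ j) := mem_flag.1 hx j hj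
  -- The values `1, -1, 1, -2, 1, -1` of `γ` are the entries just above the diagonal; `-2` requires
  -- characteristic different from two.
  match m with
  | 1 =>
    refine ⟨1, one_ne_zero, fun x hx => ?_⟩
    have h3 : x.φ 1 = 0 := h hx 3 (by norm_num)
    simp [unipotentCurve_apply, weightCoord, h3]
  | 2 =>
    refine ⟨-1, neg_ne_zero.2 one_ne_zero, fun x hx => ?_⟩
    simp [unipotentCurve_apply, weightCoord, sub_eq_add_neg]
  | 3 =>
    refine ⟨1, one_ne_zero, fun x hx => ?_⟩
    have h5 : x.v 1 = 0 := h hx 5 (by norm_num)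
    have h6 : x.v 2 = 0 := h hx 6 (by norm_num)
    simp [unipotentCurve_apply, weightCoord, h5, h6]
  | 4 =>
    refine ⟨-2, neg_ne_zero.2 two_ne_zero, fun x hx => ?_⟩
    have h6 : x.v 2 = 0 := h hx 6 (by norm_num)
    simp [unipotentCurve_apply, weightCoord, h6]
    ring
  | 5 =>
    refine ⟨1, one_ne_zero, fun x hx => ?_⟩
    simp [unipotentCurve_apply, weightCoord]
  | 6 =>
    refine ⟨-1, neg_ne_zero.2 one_ne_zero, fun x hx => ?_⟩
    simp [unipotentCurve_apply, weightCoord, sub_eq_add_neg]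

/-- An eigenvector of the regular unipotent element modulo a step of the flag lies in the
next step. -/
theorem mem_flag_succ_of_eigenvector [CharZero K] {i : ℕ} (hi : 1 ≤ i) {v : Zorn K}
    (hv : v ∉ flag i) {c : K} (h : unipotentCurve 1 v - c • v ∈ flag i) : v ∈ flag (i + 1) := by
  classical
  have hex : ∃ n, v ∈ flag n := ⟨8, by rw [flag_eight]; trivial⟩
  -- Here `m + 1` is the first index whose step contains `v`. Coordinate `m` forces `c = 1`. If `i <
  -- m`, then coordinate `m - 1` of `uv - v` is `γ` times the nonzero coordinate `m` of `v`, a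
  -- contradiction.
  obtain ⟨m, hm⟩ : ∃ m, Nat.find hex = m + 1 := by
    refine Nat.exists_eq_succ_of_ne_zero fun h0 => hv ?_
    exact monotone_flag (Nat.zero_le i) (h0 ▸ Nat.find_spec hex)
  have h1 : v ∈ flag (m + 1) := hm ▸ Nat.find_spec hex
  have h2 : v ∉ flag m := Nat.find_min hex (by omega)
  have him : i ≤ m := by
    by_contra! hlt
    exact hv (monotone_flag hlt h1)
  have hm7 : m ≤ 7 := by
    by_contra! hlt
    exact h2 (monotone_flag hlt (by rw [flag_eight]; trivial))
  have h3 : weightCoord m v ≠ 0 := fun h0 => h2 (mem_flag_of_succ h1 h0)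
  have h4 := mem_flag.1 h m him
  rw [map_sub, map_smul, weightCoord_unipotentCurve_of_mem 1 h1, smul_eq_mul] at h4
  have hc : c = 1 := by
    have : (1 - c) * weightCoord m v = 0 := by linear_combination h4
    linear_combination -(mul_eq_zero.1 this).resolve_right h3
  rcases Nat.eq_or_lt_of_le him with rfl | hlt
  · exact h1
  exfalso
  obtain ⟨k, rfl⟩ : ∃ k, m = k + 1 := ⟨m - 1, by omega⟩
  obtain ⟨γ, hγ, h5⟩ := exists_weightCoord_unipotentCurve (K := K) (m := k) (by omega) (by omega)
  have h6 := mem_flag.1 h k (by omega)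
  rw [map_sub, map_smul, h5 v h1, hc, one_smul, add_sub_cancel_left] at h6
  exact mul_ne_zero hγ h3 h6

/-- The stabilizer in `G₂` of the flag. -/
def flagGroup (K : Type u) [Field K] : Subgroup (Zorn K ≃ₗ[K] Zorn K) := G2 K ⊓ flagStabilizer flag

theorem isSolvable_flagGroup [CharZero K] : Group.IsSolvable (flagGroup K) := by
  have := isSolvable_flagStabilizer (monotone_flag (K := K)) flag_zero flag_eight flag_rank
  exact Group.isSolvable_of_isSolvable_injective
    (Subgroup.inclusion_injective (inf_le_right : flagGroup K ≤ flagStabilizer flag))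

/-- If `H` preserves `flag i`, Lie–Kolchin gives an eigenvector `v` of `H` modulo `flag i`. It is
one for the regular unipotent too, so `v` and `flag i` span `flag (i + 1)`. The step to `flag 1` is
separate and uses that `G₂` fixes the unit. -/
theorem le_flagGroup [CharZero K] [IsAlgClosed K] {H : Subgroup (Zorn K ≃ₗ[K] Zorn K)}
    (hH : H ≤ G2 K) (hconn : IsConnected (H : Set (Zorn K ≃ₗ[K] Zorn K)))
    (hsol : Group.IsSolvable H) (hu : unipotentCurve 1 ∈ H) : H ≤ flagGroup K := by
  refine le_inf hH fun h hh => mem_flagStabilizer.2 fun i => ?_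
  induction i generalizing h with
  | zero =>
    intro x hx
    rw [flag_zero, Submodule.mem_bot] at hx
    simp [hx]
  | succ i ih =>
    rcases Nat.eq_zero_or_pos i with rfl | hi
    · intro x hx
      rw [mem_flag_one hx, map_smul, (hH hh).1, ← mem_flag_one hx]
      exact hx
    · by_cases htop : (flag i : Submodule K (Zorn K)) = ⊤
      · intro x hx
        exact monotone_flag i.le_succ (by rw [htop]; trivial)
      · obtain ⟨v, hv, hv'⟩ := exists_eigenvector_mod hconn hsol (isRegular_inv hH) htop
          fun h hh => ih h hh
        obtain ⟨c, hc⟩ := hv' _ hu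
        have hvi := mem_flag_succ_of_eigenvector hi hv hc
        intro x hx
        obtain ⟨d, hd⟩ := flag_rank i v hvi x hx hv
        obtain ⟨c', hc'⟩ := hv' h hh
        have h1 := monotone_flag i.le_succ (add_mem (ih h hh _ hd) (Submodule.smul_mem _ d hc'))
        have h2 := add_mem h1 (Submodule.smul_mem _ (d * c') hvi)
        convert h2 using 1
        rw [map_sub, map_smul, smul_sub, smul_smul]
        abel

theorem exists_isBorel_le_lineStabilizer [CharZero K] [IsAlgClosed K] :
    ∃ B, IsBorel (G2 K) B ∧ B ≤ lineStabilizer e₁ := by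
  refine ⟨identityComponent (flagGroup K), isBorel_identityComponent inf_le_left
    (isClosed_G2.inter (isClosed_flagStabilizer flag)) isSolvable_flagGroup
    isConnected_range_unipotentCurve.isPreconnected ⟨0, unipotentCurve_zero⟩ ?_
    fun H hHG hconn hsol hC => le_flagGroup hHG hconn hsol (hC ⟨1, rfl⟩), ?_⟩
  · rintro _ ⟨t, rfl⟩
    exact ⟨unipotentCurve_mem_G2 t, mem_flagStabilizer.2 (unipotentCurve_mem_flag t)⟩
  · refine (identityComponent_le _).trans fun g hg => mem_lineStabilizer.2 ⟨hg.1, ?_⟩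
    exact mem_span_e₁ ((hg.2 2 e₁).2 e₁_mem_flag)
      ((G2.apply_mem_V7 hg.1).2 (IsotropicLine.ofV_mem_V7 _))

end Borel
end Zorn

/-! ### Conjugates of Borel and parabolic subgroups -/

namespace LinearAlgebraicGroup

attribute [local instance] zariskiTopologyGL

section Conjugation

variable {K : Type u} [Field K] {V : Type u} [AddCommGroup V] [Module K V]

theorem mem_conj_smul {Γ : Type*} [Group Γ] {g h : Γ} {H : Subgroup Γ} :
    h ∈ MulAut.conj g • H ↔ g⁻¹ * h * g ∈ H := by
  rw [Subgroup.mem_pointwise_smul_iff_inv_smul_mem, ← map_inv]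
  simp [MulAut.smul_def]

theorem maximal_conj_smul {Γ : Type*} [Group Γ] {G B : Subgroup Γ} {p : Subgroup Γ → Prop}
    (hp : ∀ g ∈ G, ∀ H, p H → p (MulAut.conj g • H)) {g : Γ} (hg : g ∈ G) (hB : Maximal p B) :
    Maximal p (MulAut.conj g • B) := by
  refine ⟨hp g hg B hB.1, fun H hH hle => ?_⟩
  rw [Subgroup.pointwise_smul_subset_iff, ← map_inv] at hle
  have h1 := hB.2 (hp g⁻¹ (inv_mem hg) H hH) hle
  rwa [map_inv, ← Subgroup.subset_pointwise_smul_iff] at h1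

theorem conj_smul_le {Γ : Type*} [Group Γ] {G H : Subgroup Γ} {g : Γ} (hg : g ∈ G) (hH : H ≤ G) :
    MulAut.conj g • H ≤ G := by
  intro h hh
  have h1 := mul_mem (mul_mem hg (hH (mem_conj_smul.1 hh))) (inv_mem hg)
  convert h1 using 1
  group

variable [FiniteDimensional K V]

theorem isClosed_conj_smul (g : V ≃ₗ[K] V) {H : Subgroup (V ≃ₗ[K] V)}
    (hH : IsClosed (H : Set (V ≃ₗ[K] V))) :
    IsClosed ((MulAut.conj g • H : Subgroup (V ≃ₗ[K] V)) : Set (V ≃ₗ[K] V)) := by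
  have e : ((MulAut.conj g • H : Subgroup (V ≃ₗ[K] V)) : Set (V ≃ₗ[K] V)) =
      (fun h => g⁻¹ * h * g) ⁻¹' H := by
    ext h
    exact mem_conj_smul
  rw [e]
  exact hH.preimage ((continuous_mul_right_GL g).comp (continuous_mul_left_GL g⁻¹))

theorem isConnected_conj_smul (g : V ≃ₗ[K] V) {H : Subgroup (V ≃ₗ[K] V)}
    (hH : IsConnected (H : Set (V ≃ₗ[K] V))) :
    IsConnected ((MulAut.conj g • H : Subgroup (V ≃ₗ[K] V)) : Set (V ≃ₗ[K] V)) :=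
  hH.image (fun h => g * h * g⁻¹)
    ((continuous_mul_right_GL g⁻¹).comp (continuous_mul_left_GL g)).continuousOn

theorem IsBorel.conj_smul {G B : Subgroup (V ≃ₗ[K] V)} {g : V ≃ₗ[K] V} (hg : g ∈ G)
    (hB : IsBorel G B) : IsBorel G (MulAut.conj g • B) := by
  refine maximal_conj_smul (fun g hg H ⟨h1, h2, h3, h4⟩ => ⟨conj_smul_le hg h1,
    isClosed_conj_smul g h2, isConnected_conj_smul g h3, ?_⟩) hg hB
  exact Group.isSolvable_of_surjective
    (f := (Subgroup.equivSMul (MulAut.conj g) H).toMonoidHom)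
    (Subgroup.equivSMul (MulAut.conj g) H).surjective

theorem IsParabolic.conj_smul {G P : Subgroup (V ≃ₗ[K] V)} {g : V ≃ₗ[K] V} (hg : g ∈ G)
    (hP : IsParabolic G P) : IsParabolic G (MulAut.conj g • P) := by
  obtain ⟨h1, h2, B, hB, hBP⟩ := hP
  exact ⟨conj_smul_le hg h1, isClosed_conj_smul g h2, MulAut.conj g • B, hB.conj_smul hg,
    Subgroup.pointwise_smul_le_pointwise_smul_iff.2 hBP⟩

theorem IsMaximalParabolic.conj_smul {G P : Subgroup (V ≃ₗ[K] V)} {g : V ≃ₗ[K] V} (hg : g ∈ G)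
    (hP : IsMaximalParabolic G P) : IsMaximalParabolic G (MulAut.conj g • P) := by
  refine maximal_conj_smul (fun g hg H ⟨h1, h2⟩ => ⟨h1.conj_smul hg, fun h => h2 ?_⟩) hg hP
  rw [← Subgroup.conj_smul_eq_self_of_mem hg] at h
  exact smul_left_cancel _ h

end Conjugation

end LinearAlgebraicGroup

/-! ### Maximality of the stabilizer of the line of `e₁` -/

namespace Zorn

open LinearAlgebraicGroup

section Equivariance

variable {R : Type u} [CommRing R]

theorem sl3Action_mul_expV (A : Matrix.SpecialLinearGroup (Fin 3) R) (w : Fin 3 → R) :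
    sl3Action R A * expV w = expV (A.1 *ᵥ w) * sl3Action R A := by
  refine LinearEquiv.ext fun x => ?_
  change sl3Action R A (expV w x) = expV (A.1 *ᵥ w) (sl3Action R A x)
  simp only [sl3Action_apply, expV_apply, inv_transpose_dotProduct, cross_mulVec_mulVec,
    ← Matrix.SpecialLinearGroup.coe_inv, Matrix.mulVec_add, Matrix.mulVec_sub,
    Matrix.mulVec_smul]

end Equivariance

section Maximality

variable {K : Type u} [Field K]

theorem e₁_ne_zero : (e₁ : Zorn K) ≠ 0 := IsotropicLine.ofV_ne_zero IsotropicLine.single_ne_zero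

theorem lineStabilizer_apply {g : Zorn K ≃ₗ[K] Zorn K} (hg : g ∈ G2 K) (x : Zorn K) :
    lineStabilizer (g x) = MulAut.conj g • lineStabilizer x := by
  ext h
  rw [mem_conj_smul, mem_lineStabilizer, mem_lineStabilizer]
  refine and_congr ⟨fun hh => mul_mem (mul_mem (inv_mem hg) hh) hg, fun hh => ?_⟩ ?_
  · have h1 := mul_mem (mul_mem hg hh) (inv_mem hg)
    convert h1 using 1
    group
  · simp only [Submodule.mem_span_singleton]
    refine exists_congr fun c => ?_
    change c • g x = h (g x) ↔ c • x = g.symm (h (g x))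
    rw [LinearEquiv.eq_symm_apply, map_smul]

theorem expV_mem_lineStabilizer (c : K) : expV (Pi.single 0 c) ∈ lineStabilizer (e₁ : Zorn K) := by
  refine mem_lineStabilizer.2 ⟨expV_mem_G2 _, Submodule.mem_span_singleton.2 ⟨1, ?_⟩⟩
  apply ext_coord <;> simp [e₁, ofV, cross_zero, cross_one, cross_two]

theorem expΦ_mem_lineStabilizer {ψ : Fin 3 → K} (h : ψ 0 = 0) :
    expΦ ψ ∈ lineStabilizer (e₁ : Zorn K) := by
  refine mem_lineStabilizer.2 ⟨expΦ_mem_G2 _, Submodule.mem_span_singleton.2 ⟨1, ?_⟩⟩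
  apply ext_coord <;> simp [e₁, ofV, h]

theorem lineStabilizer_e₁_ne : lineStabilizer (e₁ : Zorn K) ≠ G2 K := by
  intro h
  have h1 : swap ∈ lineStabilizer (e₁ : Zorn K) := h ▸ swap_mem_G2
  obtain ⟨c, hc⟩ := Submodule.mem_span_singleton.1 (mem_lineStabilizer.1 h1).2
  have h2 := congrFun (congrArg Zorn.φ hc) 0
  simp [e₁, ofV] at h2

variable {Q : Subgroup (Zorn K ≃ₗ[K] Zorn K)}

theorem mem_of_apply_e₁_eq (hQ : Q ≤ G2 K) (hP : lineStabilizer e₁ ≤ Q)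
    {g q : Zorn K ≃ₗ[K] Zorn K} (hg : g ∈ G2 K) (hq : q ∈ Q) (h : q e₁ = g e₁) : g ∈ Q := by
  have h1 : q⁻¹ * g ∈ lineStabilizer (e₁ : Zorn K) := by
    refine mem_lineStabilizer.2 ⟨mul_mem (inv_mem (hQ hq)) hg,
      Submodule.mem_span_singleton.2 ⟨1, ?_⟩⟩
    change (1 : K) • e₁ = q.symm (g e₁)
    rw [← h, q.symm_apply_apply, one_smul]
  simpa using mul_mem hq (hP h1)

/-- The witnesses are transvections `1 + x yᵀ` with `φ(x) = 0` and `y ⬝ x = 0`, chosen to move `e₁`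
off its line. -/
theorem exists_sl3_fixing {φ : Fin 3 → K} (hφ : φ ≠ 0) :
    ∃ A : Matrix.SpecialLinearGroup (Fin 3) K, (A⁻¹).1ᵀ *ᵥ φ = φ ∧
      ((A.1 *ᵥ Pi.single 0 1) 1 ≠ 0 ∨ (A.1 *ᵥ Pi.single 0 1) 2 ≠ 0) := by
  have key (A : Matrix.SpecialLinearGroup (Fin 3) K) (h : A.1ᵀ *ᵥ φ = φ) :
      (A⁻¹).1ᵀ *ᵥ φ = φ := by
    have h1 : A.1 * (A⁻¹).1 = 1 := congrArg Subtype.val (mul_inv_cancel A)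
    conv_lhs => rw [← h]
    rw [Matrix.mulVec_mulVec, ← Matrix.transpose_mul, h1, Matrix.transpose_one, Matrix.one_mulVec]
  by_cases h0 : φ 0 = 0
  · let A : Matrix.SpecialLinearGroup (Fin 3) K :=
      ⟨!![1, 0, 0; -φ 2, 1, 0; φ 1, 0, 1], by simp [Matrix.det_fin_three]⟩
    have hA : A.1 = !![1, 0, 0; -φ 2, 1, 0; φ 1, 0, 1] := rfl
    refine ⟨A, key A ?_, ?_⟩
    · rw [hA]
      funext i
      fin_cases i <;> simp [Matrix.mulVec, dotProduct, Fin.sum_univ_three] <;> ring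
    · rw [hA]
      by_contra! hc
      refine hφ ?_
      funext i
      fin_cases i
      · exact h0
      · simpa using hc.2
      · simpa using hc.1
  · let A : Matrix.SpecialLinearGroup (Fin 3) K :=
      ⟨!![1 - φ 1 * φ 0, -φ 1 ^ 2, 0; φ 0 ^ 2, 1 + φ 0 * φ 1, 0; 0, 0, 1], by
        simp [Matrix.det_fin_three]; ring⟩
    have hA : A.1 = !![1 - φ 1 * φ 0, -φ 1 ^ 2, 0; φ 0 ^ 2, 1 + φ 0 * φ 1, 0; 0, 0, 1] := rfl
    refine ⟨A, key A ?_, Or.inl ?_⟩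
    · rw [hA]
      funext i
      fin_cases i <;> simp [Matrix.mulVec, dotProduct, Fin.sum_univ_three] <;> ring
    · rw [hA]
      simpa using h0

theorem exists_sl3_mem_of_ofV (hQ : Q ≤ G2 K) (hP : lineStabilizer e₁ ≤ Q) {v : Fin 3 → K}
    (hv : v 1 ≠ 0 ∨ v 2 ≠ 0) (h : ∃ q ∈ Q, q e₁ = ofV v) :
    ∃ A : Matrix.SpecialLinearGroup (Fin 3) K, sl3Action K A ∈ Q ∧
      ((A.1 *ᵥ Pi.single 0 1) 1 ≠ 0 ∨ (A.1 *ᵥ Pi.single 0 1) 2 ≠ 0) := by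
  obtain ⟨q, hq, hqe⟩ := h
  obtain ⟨A, hA⟩ := exists_sl3_apply_eq (v := v) (by rintro rfl; simp at hv)
  refine ⟨A, mem_of_apply_e₁_eq hQ hP (sl3Action_mem_G2 A) hq ?_, by rwa [hA]⟩
  rw [hqe, e₁, sl3Action_ofV, hA]

/-- If `A` fixes `φ`, then `Aq` and `q` agree on `e₁`, so `Aq`, and with it `A`, belongs to `Q`. -/
theorem exists_sl3_mem_of_ofΦ (hQ : Q ≤ G2 K) (hP : lineStabilizer e₁ ≤ Q) {φ : Fin 3 → K}
    (hφ : φ ≠ 0) (h : ∃ q ∈ Q, q e₁ = ofΦ φ) :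
    ∃ A : Matrix.SpecialLinearGroup (Fin 3) K, sl3Action K A ∈ Q ∧
      ((A.1 *ᵥ Pi.single 0 1) 1 ≠ 0 ∨ (A.1 *ᵥ Pi.single 0 1) 2 ≠ 0) := by
  obtain ⟨q, hq, hqe⟩ := h
  obtain ⟨A, hA, hA'⟩ := exists_sl3_fixing hφ
  refine ⟨A, ?_, hA'⟩
  have h1 : sl3Action K A * q ∈ Q := by
    refine mem_of_apply_e₁_eq hQ hP (mul_mem (sl3Action_mem_G2 A) (hQ hq)) hq ?_
    change q e₁ = sl3Action K A (q e₁)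
    rw [hqe, sl3Action_ofΦ, hA]
  simpa using mul_mem h1 (inv_mem hq)

/-- A group that strictly contains the stabilizer of `e₁` contains an element of `SL₃` that does
not fix the line through `e₁`. -/
theorem exists_sl3_mem (hQ : Q ≤ G2 K) (hP : lineStabilizer e₁ ≤ Q)
    {q : Zorn K ≃ₗ[K] Zorn K} (hq : q ∈ Q) (hqP : q ∉ lineStabilizer e₁) :
    ∃ A : Matrix.SpecialLinearGroup (Fin 3) K, sl3Action K A ∈ Q ∧
      ((A.1 *ᵥ Pi.single 0 1) 1 ≠ 0 ∨ (A.1 *ᵥ Pi.single 0 1) 2 ≠ 0) := by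
  have trans {x y : Zorn K} {p : Zorn K ≃ₗ[K] Zorn K} (hp : p ∈ lineStabilizer e₁)
      (hxy : p x = y) (hx : ∃ q ∈ Q, q e₁ = x) : ∃ q ∈ Q, q e₁ = y := by
    obtain ⟨q, hq, rfl⟩ := hx
    exact ⟨p * q, mul_mem (hP hp) hq, hxy⟩
  have orth {v φ : Fin 3 → K} (h : ∃ q ∈ Q, q e₁ = ⟨0, v, φ, 0⟩) : φ ⬝ᵥ v = 0 := by
    obtain ⟨q, hq, hqe⟩ := h
    have h1 := norm_apply_of_mem_G2 (hQ hq) e₁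
    rw [hqe, e₁, IsotropicLine.norm_ofV] at h1
    simpa only [norm, zero_mul, zero_sub, neg_eq_zero] using h1
  have kill {v φ ψ : Fin 3 → K} (h : ∃ q ∈ Q, q e₁ = ⟨0, v, φ, 0⟩) (hψ : ψ 0 = 0)
      (hv : crossProduct ψ φ = -v) : ∃ q ∈ Q, q e₁ = ofΦ φ := by
    refine trans (expΦ_mem_lineStabilizer hψ) ?_ h
    have h1 : v ⬝ᵥ ψ = 0 := by
      rw [← neg_neg v, ← hv, neg_dotProduct, dotProduct_comm, dot_self_cross, neg_zero]
    ext1 <;> simp [ofΦ, h1, hv]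
  obtain ⟨a, v, φ, d, hy⟩ : ∃ a v φ d, q e₁ = (⟨a, v, φ, d⟩ : Zorn K) := ⟨_, _, _, _, rfl⟩
  have hy' : ∃ q ∈ Q, q e₁ = ⟨a, v, φ, d⟩ := ⟨q, hq, hy⟩
  have ht : (q e₁).a + (q e₁).d = 0 :=
    (G2.apply_mem_V7 (hQ hq)).2 (IsotropicLine.ofV_mem_V7 _)
  have hn : norm (q e₁) = 0 := by
    rw [norm_apply_of_mem_G2 (hQ hq), e₁, IsotropicLine.norm_ofV]
  rw [hy] at ht hn
  obtain rfl : d = -a := by linear_combination ht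
  have hn' : a * -a - φ ⬝ᵥ v = 0 := hn
  by_cases h0 : φ 0 = 0
  · by_cases hv : v 1 ≠ 0 ∨ v 2 ≠ 0
    · obtain ⟨ψ, hψ, hψv⟩ : ∃ ψ : Fin 3 → K, ψ 0 = 0 ∧ v ⬝ᵥ ψ = a := by
        rcases hv with h | h
        · exact ⟨Pi.single 1 (a / v 1), by simp, by simp; field_simp⟩
        · exact ⟨Pi.single 2 (a / v 2), by simp, by simp; field_simp⟩
      have h1 := trans (y := ⟨0, v + crossProduct ψ φ, φ + a • ψ, 0⟩)
        (expΦ_mem_lineStabilizer hψ) (by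
          rw [expΦ_apply, hψv]
          apply ext_coord <;> simp <;> ring) hy'
      have h2 := orth h1
      have e1 : (v + crossProduct ψ φ) 1 = v 1 := by simp [cross_one, h0, hψ]
      have e2 : (v + crossProduct ψ φ) 2 = v 2 := by simp [cross_two, h0, hψ]
      have e3 : (φ + a • ψ) 0 = 0 := by simp [h0, hψ]
      generalize v + crossProduct ψ φ = v' at h1 h2 e1 e2
      generalize φ + a • ψ = φ' at h1 h2 e3
      rw [← e1, ← e2] at hv
      rw [Matrix.vec3_dotProduct, e3, zero_mul, zero_add] at h2
      -- As `φ' 0 = 0` and `φ'(v') = 0`, the form `φ'` is `(c e₁) ∧ v'`, which `expV (c e₁)`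
      -- removes.
      obtain ⟨c, hc1, hc2⟩ : ∃ c, φ' 1 = -(c * v' 2) ∧ φ' 2 = c * v' 1 := by
        rcases hv with h | h
        · refine ⟨φ' 2 / v' 1, ?_, by field_simp⟩
          field_simp
          linear_combination h2
        · refine ⟨-φ' 1 / v' 2, by field_simp, ?_⟩
          field_simp
          linear_combination h2
      refine exists_sl3_mem_of_ofV hQ hP hv (trans (expV_mem_lineStabilizer c) ?_ h1)
      apply ext_coord <;> simp [ofV, cross_zero, cross_one, cross_two, hc1, hc2, e3]
    · push Not at hv
      have ha : a = 0 := by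
        rw [Matrix.vec3_dotProduct, h0, hv.1, hv.2] at hn'
        simpa using hn'
      subst ha
      rw [neg_zero] at hy'
      have hφ : φ ≠ 0 := by
        rintro rfl
        refine hqP (mem_lineStabilizer.2 ⟨hQ hq, Submodule.mem_span_singleton.2 ⟨v 0, ?_⟩⟩)
        rw [hy]
        apply ext_coord <;> simp [e₁, ofV, hv]
      obtain ⟨ψ, hψ⟩ := exists_cross_eq (v := φ) (φ := -v) hφ
        (by rw [neg_dotProduct, dotProduct_comm, orth hy', neg_zero])
      refine exists_sl3_mem_of_ofΦ hQ hP hφ (kill hy' ?_ hψ)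
      have h1 := congrFun hψ 1
      have h2 := congrFun hψ 2
      simp only [cross_one, cross_two, h0, Pi.neg_apply, hv.1, hv.2] at h1 h2
      by_contra hψ0
      refine hφ ?_
      funext i
      fin_cases i
      · exact h0
      · simpa [hψ0] using h2
      · simpa [hψ0] using h1
  -- With `φ 0 ≠ 0`, a multiple of `e₁` suffices to clear the diagonal by an element of the
  -- stabilizer.
  · have h1 := trans (y := ⟨0, v + (-a - a) • Pi.single 0 (-a / φ 0) + a • Pi.single 0 (-a / φ 0),
      φ - crossProduct (Pi.single 0 (-a / φ 0)) v, 0⟩) (expV_mem_lineStabilizer (-a / φ 0)) (by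
        have e : φ 0 * (-a / φ 0) = -a := by field_simp
        rw [expV_apply]
        ext1 <;> simp [e]) hy'
    have h2 := orth h1
    have h3 : (φ - crossProduct (Pi.single 0 (-a / φ 0)) v) 0 ≠ 0 := by
      simpa [cross_zero] using h0
    generalize v + (-a - a) • Pi.single 0 (-a / φ 0) + a • Pi.single 0 (-a / φ 0) = v' at h1 h2
    generalize φ - crossProduct (Pi.single 0 (-a / φ 0)) v = φ' at h1 h2 h3
    have hφ : φ' ≠ 0 := fun h => h3 (congrFun h 0)
    obtain ⟨ψ, hψ⟩ := exists_cross_eq (v := φ') (φ := -v') hφ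
      (by rw [neg_dotProduct, dotProduct_comm, h2, neg_zero])
    -- A multiple of `φ'` may be subtracted from `ψ` without changing `ψ ∧ φ'`; this one makes `ψ 0`
    -- vanish.
    refine exists_sl3_mem_of_ofΦ hQ hP hφ
      (kill (ψ := ψ - (ψ 0 / φ' 0) • φ') h1 ?_ ?_)
    · simp; field_simp; simp
    · simp [hψ]

/-- The stabilizer of `e₁` in `SL₃` is transitive on vectors off the line of `e₁`, so one element
moving this line generates the rest. -/
theorem sl3Action_mem_of_exists (hQ : Q ≤ G2 K) (hP : lineStabilizer e₁ ≤ Q)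
    (h : ∃ A : Matrix.SpecialLinearGroup (Fin 3) K, sl3Action K A ∈ Q ∧
      ((A.1 *ᵥ Pi.single 0 1) 1 ≠ 0 ∨ (A.1 *ᵥ Pi.single 0 1) 2 ≠ 0))
    (A : Matrix.SpecialLinearGroup (Fin 3) K) : sl3Action K A ∈ Q := by
  obtain ⟨B, hB, hB'⟩ := h
  have fix {p : Matrix.SpecialLinearGroup (Fin 3) K}
      (hp : p.1 *ᵥ Pi.single 0 1 = Pi.single 0 1) : sl3Action K p ∈ Q := by
    refine hP (mem_lineStabilizer.2 ⟨sl3Action_mem_G2 p, ?_⟩)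
    rw [e₁, sl3Action_ofV, hp]
    exact Submodule.mem_span_singleton_self _
  by_cases hA : (A.1 *ᵥ Pi.single 0 1) 1 ≠ 0 ∨ (A.1 *ᵥ Pi.single 0 1) 2 ≠ 0
  · obtain ⟨p, hp, hp'⟩ := exists_sl3_of_ne hA
    obtain ⟨r, hr, hr'⟩ := exists_sl3_of_ne hB'
    refine mem_of_apply_e₁_eq hQ hP (sl3Action_mem_G2 A)
      (mul_mem (mul_mem (fix hp) (inv_mem (fix hr))) hB) ?_
    change sl3Action K p ((sl3Action K r).symm (sl3Action K B e₁)) = _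
    rw [e₁, sl3Action_ofV, sl3Action_ofV, ← hr', ← sl3Action_ofV, LinearEquiv.symm_apply_apply,
      sl3Action_ofV, hp']
  · push Not at hA
    refine hP (mem_lineStabilizer.2 ⟨sl3Action_mem_G2 A,
      Submodule.mem_span_singleton.2 ⟨(A.1 *ᵥ Pi.single 0 1) 0, ?_⟩⟩)
    rw [e₁, sl3Action_ofV, ← ofV_smul]
    congr 1
    funext i
    fin_cases i
    · simp
    · simpa using hA.1.symm
    · simpa using hA.2.symm

theorem expV_mem_of_sl3 (hP : lineStabilizer e₁ ≤ Q) (hA : ∀ A, sl3Action K A ∈ Q)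
    (w : Fin 3 → K) : expV w ∈ Q := by
  by_cases hw : w = 0
  · subst hw
    convert one_mem Q
    refine LinearEquiv.ext fun x => ?_
    ext1 <;> simp
  · obtain ⟨A, rfl⟩ := exists_sl3_apply_eq hw
    have h1 := mul_mem (mul_mem (hA A) (hP (expV_mem_lineStabilizer 1))) (inv_mem (hA A))
    rwa [sl3Action_mul_expV, mul_inv_cancel_right] at h1

/-- It suffices that `Q` reaches `swap e₁`, the dual vector `-e₁*`: `expV e₃` takes `e₁` to `e₁ -
e₂*`, then `expΦ (-e₃*)` leaves `-e₂*`, and `A` turns this into `-e₁*`. -/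
theorem swap_mem_of_sl3 (hQ : Q ≤ G2 K) (hP : lineStabilizer e₁ ≤ Q)
    (hA : ∀ A, sl3Action K A ∈ Q) : swap ∈ Q := by
  let A : Matrix.SpecialLinearGroup (Fin 3) K :=
    ⟨!![0, 1, 0; -1, 0, 0; 0, 0, 1], by simp [Matrix.det_fin_three]⟩
  have hA1 : A.1 = !![0, 1, 0; -1, 0, 0; 0, 0, 1] := rfl
  have hA2 : (A⁻¹).1ᵀ = !![0, 1, 0; -1, 0, 0; 0, 0, 1] := by
    rw [Matrix.SpecialLinearGroup.coe_inv, hA1, Matrix.adjugate_fin_three]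
    ext i j
    fin_cases i <;> fin_cases j <;> simp
  refine mem_of_apply_e₁_eq hQ hP swap_mem_G2 (mul_mem (mul_mem (hA A)
    (hP (expΦ_mem_lineStabilizer (ψ := Pi.single 2 (-1)) (by simp))))
    (expV_mem_of_sl3 hP hA (Pi.single 2 1))) ?_
  change sl3Action K A (expΦ _ (expV _ e₁)) = _
  rw [sl3Action_apply, hA1, hA2]
  apply ext_coord <;> simp [e₁, ofV, Matrix.mulVec, dotProduct, Fin.sum_univ_three, cross_zero,
    cross_one, cross_two]

/-- The stabilizer of the line through `e₁` is a maximal subgroup of `G₂`. -/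
theorem eq_G2_of_lineStabilizer_lt (hQ : Q ≤ G2 K) (hP : lineStabilizer e₁ ≤ Q)
    (hne : ¬ Q ≤ lineStabilizer e₁) : Q = G2 K := by
  obtain ⟨q, hq, hqP⟩ := SetLike.not_le_iff_exists.1 hne
  have hA := sl3Action_mem_of_exists hQ hP (exists_sl3_mem hQ hP hq hqP)
  refine le_antisymm hQ fun g hg => ?_
  obtain ⟨r, hr, hre⟩ := exists_apply_e₁_eq (expV_mem_of_sl3 hP hA) (swap_mem_of_sl3 hQ hP hA) hA
    (x := g e₁) (by simpa only [ne_eq, LinearEquiv.map_eq_zero_iff] using e₁_ne_zero)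
    ((G2.apply_mem_V7 hg).2 (IsotropicLine.ofV_mem_V7 _))
    (by rw [norm_apply_of_mem_G2 hg, e₁, IsotropicLine.norm_ofV])
  exact mem_of_apply_e₁_eq hQ hP hg hr hre

theorem isMaximalParabolic_lineStabilizer_e₁ [CharZero K] [IsAlgClosed K] :
    IsMaximalParabolic (G2 K) (lineStabilizer e₁) := by
  refine ⟨⟨⟨inf_le_left, isClosed_lineStabilizer _, exists_isBorel_le_lineStabilizer⟩,
    lineStabilizer_e₁_ne⟩, fun Q hQ hle => ?_⟩
  by_contra hne
  exact hQ.2 (eq_G2_of_lineStabilizer_lt hQ.1.1 hle hne)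

theorem isMaximalParabolic_lineStabilizer [CharZero K] [IsAlgClosed K] {x : Zorn K} (hx : x ≠ 0)
    (ht : x ∈ V7 K) (hn : norm x = 0) : IsMaximalParabolic (G2 K) (lineStabilizer x) := by
  obtain ⟨g, hg, rfl⟩ := exists_G2_apply_e₁_eq hx ht hn
  rw [lineStabilizer_apply hg]
  exact isMaximalParabolic_lineStabilizer_e₁.conj_smul hg

end Maximality

/-! ### Extension of scalars and the main theorem -/

section BaseChange

variable {F : Type u} [Field F] {K : Type u} [Field K] [Algebra F K]

theorem norm_map_algebra (x : Zorn F) : norm (map K x) = algebraMap F K (norm x) := by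
  simp [norm, map, Matrix.vec3_dotProduct]

theorem map_ne_zero_of_ne_zero {x : Zorn F} (hx : x ≠ 0) : map K x ≠ 0 := by
  intro h
  refine hx (Zorn.ext ?_ ?_ ?_ ?_)
  · simpa [map] using congrArg Zorn.a h
  · funext i
    simpa [map] using congrFun (congrArg Zorn.v h) i
  · funext i
    simpa [map] using congrFun (congrArg Zorn.φ h) i
  · simpa [map] using congrArg Zorn.d h

theorem isMaximalParabolic_stabilizerPoints [CharZero F] [IsAlgClosed K] (ℓ : IsotropicLine F)
    (hℓ : ℓ.line ≤ V7 F) : IsMaximalParabolic (G2 K) (stabilizerPoints ℓ.line K) := by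
  have : CharZero K := charZero_of_injective_algebraMap (algebraMap F K).injective
  obtain ⟨x, hx, hn, e⟩ := ℓ.exists_eq_span
  rw [e, IsotropicLine.span_le_V7, mem_V7] at hℓ
  have e' : stabilizerPoints ℓ.line K = lineStabilizer (map K x) := by
    rw [stabilizerPoints, e, baseChange_span_singleton, lineStabilizer]
  rw [e']
  refine isMaximalParabolic_lineStabilizer (map_ne_zero_of_ne_zero hx) ?_ ?_
  · rw [mem_V7]
    simp [map, ← map_add, hℓ]
  · rw [norm_map_algebra, hn, map_zero]

end BaseChange
end Zorn

theorem mainTheorem7 (F : Type u) [Field F] [CharZero F] :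
    -- there are exactly two orbits on isotropic lines, told apart by tracelessness
    Nat.card (MulAction.orbitRel.Quotient (Zorn.G2 F) (Zorn.IsotropicLine F)) = 2 ∧
    (∀ ℓ ℓ' : Zorn.IsotropicLine F,
      ℓ' ∈ MulAction.orbit (Zorn.G2 F) ℓ ↔ (ℓ.line ≤ Zorn.V7 F ↔ ℓ'.line ≤ Zorn.V7 F)) ∧
    -- representatives of the two orbits
    (∀ v : Fin 3 → F, v ≠ 0 → ∃ ℓ : Zorn.IsotropicLine F,
      ℓ.line = Submodule.span F {(⟨0, v, 0, 0⟩ : Zorn F)} ∧ ℓ.line ≤ Zorn.V7 F) ∧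
    (∃ ℓ : Zorn.IsotropicLine F,
      ℓ.line = Submodule.span F {Zorn.eps1 F} ∧ ¬ ℓ.line ≤ Zorn.V7 F) ∧
    -- the stabilizer of a traceless isotropic line is a maximal parabolic subgroup
    (∀ ℓ : Zorn.IsotropicLine F, ℓ.line ≤ Zorn.V7 F →
      ∀ (K : Type u) [Field K] [Algebra F K] [IsAlgClosed K],
        LinearAlgebraicGroup.IsMaximalParabolic (Zorn.G2 K) (Zorn.stabilizerPoints ℓ.line K)) ∧
    -- the stabilizer of the line through `ε₁` is `SL₃`, as group functors
    (∀ (R : Type u) [CommRing R] [Algebra F R],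
      Function.Injective (Zorn.sl3Action R) ∧
      (Zorn.sl3Action R).range =
        Zorn.stabilizerPoints (Submodule.span F {Zorn.eps1 F}) R) :=
  ⟨Zorn.IsotropicLine.card_orbits, Zorn.IsotropicLine.mem_orbit_iff,
    fun v hv => ⟨Zorn.IsotropicLine.lineV v hv, rfl, Zorn.IsotropicLine.lineV_le v hv⟩,
    ⟨Zorn.IsotropicLine.lineEps1, rfl, Zorn.IsotropicLine.lineEps1_not_le⟩,
    fun ℓ hℓ _ _ _ _ => Zorn.isMaximalParabolic_stabilizerPoints ℓ hℓ,
    fun _ _ _ => ⟨Zorn.sl3Action_injective, Zorn.range_sl3Action_eq_stabilizerPoints⟩⟩
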